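/- Let $\mathbb F$ be a field, $d\ge 0$, and for $(\alpha,a)\in\mathbb F^{d}\times\mathbb F=\mathbb F^{d+1}$ put $H_{\alpha,a}=\{x\in\mathbb F^d:\alpha\cdot x=a\}$. Let $\mathcal A=\{H_{\alpha_i,a_i}: 1\le i\le m\}$ be an arrangement of hyperplanes in $\mathbb F^d$ ($\alpha_i\ne 0$ for all $i$) that is essential, i.e. $\alpha_1,\dots,\alpha_m$ span $\mathbb F^d$. For a finite collection $\mathcal B$ of subsets of $V=\mathbb F^n$, each defined by one equation $\beta\cdot x=b$, let $L(\mathcal B)$ be the set of all nonempty intersections of members of $\mathcal B$ (including $V$), ordered by reverse inclusion, with Möbius function $\mu$. For $X\in L(\mathcal B)$ let $\mathcal B/X=\{H\cap X : H\in\mathcal B,\ X\not\subseteq H,\ H\cap X\neq\emptyset\}$ and $M(\mathcal B/X)=X\setminus\bigcup_{K\in\mathcal B/X}K$, and let $M(\mathcal B)=V\setminus\bigcup_{H\in\mathcal B}H$. Each $x\in V$ lies in $M(\mathcal B/X)$ for exactly one $X\in L(\mathcal B)$, denoted $X_x$. Let $\mathcal A^o=\{H_{\alpha_i,0}\}$.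 The induced adjoint arrangement $\tilde{\mathcal A}$ consists of the hyperplanes in $\mathbb F^{d+1}$ through the origin with normal vectors $(v,-1)$, for the $0$-dimensional members $\{v\}$ of $L(\mathcal A)$, and $(u,0)$, for the $1$-dimensional members $\mathbb F u$ of $L(\mathcal A^o)$. For $\mathcal B$ in $\mathbb F^d$ define integers $c_{ij}(\mathcal B)$ $(0\le j\le i\le d)$ and $w_k^+(\mathcal B)$ $(0\le k\le d)$ by $$\sum_{X\le Y\text{ in }L(\mathcal B)}\mu(X,Y)s^{d-\dim X}t^{\dim Y}=\sum_{0\le j\le i\le d}(-1)^jc_{ij}(\mathcal B)s^{d-i}t^{i-j},\qquad \sum_{X\in L(\mathcal B)}\mu(V,X)t^{\dim X}=\sum_{k=0}^d(-1)^kw_k^+(\mathcal B)t^{d-k},$$ except that all $c_{ij}(\mathcal B)$ and $w^+_k(\mathcal B)$ are $0$ if $V\in\mathcal B$. Let $W_k(\mathcal B)$ be the number of members of $L(\mathcal B)$ of codimension $k$. If $\mathbb F=\mathbb R$, let $r(\mathcal B)$ be the number of connected components of $M(\mathcal B)$, and $f_k(\mathcal B)$ the number of $k$-dimensional faces, i.e.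 of connected components of the sets $M(\mathcal B/X)$ with $X\in L(\mathcal B)$, $\dim X=k$. For $(\alpha,a)\in\mathbb F^{d+1}$ write $\mathcal A+H_{\alpha,a}=\mathcal A\cup\{H_{\alpha,a}\}$. Let $(\alpha,a),(\alpha',a')\in\mathbb F^{d+1}$ satisfy $X_{(\alpha,a)}\subseteq X_{(\alpha',a')}$ in $L(\tilde{\mathcal A})$. Then $$c_{ij}(\mathcal A+H_{\alpha,a})\le c_{ij}(\mathcal A+H_{\alpha',a'})\qquad(0\le j\le i\le d),$$ $$w_i^+(\mathcal A+H_{\alpha,a})\le w_i^+(\mathcal A+H_{\alpha',a'}),\qquad W_i(\mathcal A+H_{\alpha,a})\le W_i(\mathcal A+H_{\alpha',a'})\qquad(0\le i\le d),$$ and, if $\mathbb F=\mathbb R$, also $$f_i(\mathcal A+H_{\alpha,a})\le f_i(\mathcal A+H_{\alpha',a'})\quad(0\le i\le d),\qquad r(\mathcal A+H_{\alpha,a})\le r(\mathcal A+H_{\alpha',a'}).$$ -/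

import Mathlib

open scoped Polynomial

namespace HypArr

/-- The solution set `H_{α,a}` of `α · x = a` in `F^d`. It is a hyperplane when `α ≠ 0`; it is the
whole space for `(α, a) = (0, 0)` and empty for `α = 0`, `a ≠ 0`. -/
def hyperplane {F : Type*} [Field F] {d : ℕ} (α : Fin d → F) (a : F) : Set (Fin d → F) :=
  {x | α ⬝ᵥ x = a}

/-- The arrangement `{H_{β_i,b_i} | i ∈ [m]}`. -/
abbrev arrangement {F : Type*} [Field F] {d m : ℕ} (β : Fin m → Fin d → F) (b : Fin m → F) :
    Set (Set (Fin d → F)) :=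
  Set.range fun i => hyperplane (β i) (b i)

/-- The one-element extension `𝒜 + H_{α,a}`. -/
abbrev extension {F : Type*} [Field F] {d : ℕ} (𝒜 : Set (Set (Fin d → F)))
    (α : Fin d → F) (a : F) : Set (Set (Fin d → F)) :=
  insert (hyperplane α a) 𝒜

/-- The intersection semi-lattice `L(𝒜)`: all nonempty intersections of members of `𝒜`,
including the whole space (the intersection of the empty subfamily). -/
def L {V : Type*} (𝒜 : Set (Set V)) : Set (Set V) :=
  {X | X.Nonempty ∧ ∃ ℬ ⊆ 𝒜, X = ⋂₀ ℬ}

instance {V : Type*} (𝒜 : Set (Set V)) [Finite 𝒜] : Finite (L 𝒜) := by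
  have h : (𝒜.powerset).Finite := (Set.toFinite 𝒜).powerset
  refine ((h.image fun ℬ => ⋂₀ ℬ).subset ?_).to_subtype
  rintro X ⟨-, ℬ, hℬ, rfl⟩
  exact ⟨ℬ, hℬ, rfl⟩

/-- The dimension of a (nonempty) affine subspace of `F^d`. -/
noncomputable def dim {F : Type*} [Field F] {d : ℕ} (X : Set (Fin d → F)) : ℕ :=
  Module.finrank F (vectorSpan F X)

/-- The localization `𝒜_X = {H ∈ 𝒜 | X ⊆ H}`. -/
def localization {V : Type*} (𝒜 : Set (Set V)) (X : Set V) : Set (Set V) :=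
  {H | H ∈ 𝒜 ∧ X ⊆ H}

/-- The restriction `𝒜/X = {H ∩ X ≠ ∅ | H ∈ 𝒜 \ 𝒜_X}`, an arrangement in `X`. -/
def restriction {V : Type*} (𝒜 : Set (Set V)) (X : Set V) : Set (Set V) :=
  {K | ∃ H ∈ 𝒜 \ localization 𝒜 X, K = H ∩ X ∧ K.Nonempty}

/-- The complement `M(ℬ) = X \ ⋃_{H ∈ ℬ} H` of an arrangement `ℬ` in the ambient space `X`. -/
def complement {V : Type*} (X : Set V) (ℬ : Set (Set V)) : Set V :=
  X \ ⋃₀ ℬ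

/-- The Möbius function `μ(X, Y)` of `L(𝒜)` ordered by reverse inclusion. -/
noncomputable def mobius {V : Type*} (𝒜 : Set (Set V)) [Finite 𝒜] (X Y : L 𝒜) : ℤ := by
  classical
  letI : Fintype (L 𝒜)ᵒᵈ := Fintype.ofFinite _
  letI : LocallyFiniteOrder (L 𝒜)ᵒᵈ := Fintype.toLocallyFiniteOrder
  exact IncidenceAlgebra.mu ℤ (OrderDual.toDual X) (OrderDual.toDual Y)

open Classical in
/-- The characteristic polynomial `χ(𝒜, t) = ∑_{X ∈ L(𝒜)} μ(V, X) t^{dim X}`, with `χ(𝒜, t) = 0`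
when the ambient space `V = F^d` is a member of `𝒜`. -/
noncomputable def charPoly {F : Type*} [Field F] {d : ℕ} (𝒜 : Set (Set (Fin d → F)))
    [Finite 𝒜] : ℤ[X] :=
  letI : Fintype (L 𝒜) := Fintype.ofFinite _
  if Set.univ ∈ 𝒜 then 0
  else ∑ X : L 𝒜,
    Polynomial.C (mobius 𝒜 ⟨Set.univ, Set.univ_nonempty, ∅, Set.empty_subset _, by simp⟩ X) *
      Polynomial.X ^ dim (X : Set (Fin d → F))

open Classical in
/-- The Whitney polynomial `w(𝒜; s, t) = ∑_{X ≤ Y} μ(X, Y) s^{d - dim X} t^{dim Y}`, with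
`w(𝒜; s, t) = 0` when the ambient space is a member of `𝒜`. The outer variable of `ℤ[X][X]` is `s`
and the inner one is `t`; `X ≤ Y` in `L(𝒜)` means `Y ⊆ X`. -/
noncomputable def whitneyPoly {F : Type*} [Field F] {d : ℕ} (𝒜 : Set (Set (Fin d → F)))
    [Finite 𝒜] : ℤ[X][X] :=
  letI : Fintype (L 𝒜) := Fintype.ofFinite _
  if Set.univ ∈ 𝒜 then 0
  else ∑ X : L 𝒜, ∑ Y ∈ (Finset.univ : Finset (L 𝒜)).filter (fun Y => Y.1 ⊆ X.1),
    Polynomial.C (Polynomial.C (mobius 𝒜 X Y) * Polynomial.X ^ dim (Y : Set (Fin d → F))) *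
      Polynomial.X ^ (d - dim (X : Set (Fin d → F)))

/-- `c_{ij}(𝒜)` for `j ≤ i ≤ d`: `w(𝒜; s, t) = ∑_{j ≤ i ≤ d} (-1)^j c_{ij}(𝒜) s^{d-i} t^{i-j}`. -/
noncomputable def whitneyCoeff {F : Type*} [Field F] {d : ℕ} (𝒜 : Set (Set (Fin d → F)))
    [Finite 𝒜] (i j : ℕ) : ℤ :=
  (-1) ^ j * ((whitneyPoly 𝒜).coeff (d - i)).coeff (i - j)

/-- The unsigned Whitney number of the first kind `w_k^+(𝒜)` for `k ≤ d`:
`χ(𝒜, t) = ∑_{k ≤ d} (-1)^k w_k^+(𝒜) t^{d-k}`. -/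
noncomputable def whitneyFirst {F : Type*} [Field F] {d : ℕ} (𝒜 : Set (Set (Fin d → F)))
    [Finite 𝒜] (k : ℕ) : ℤ :=
  (-1) ^ k * (charPoly 𝒜).coeff (d - k)

/-- The Whitney number of the second kind `W_k(𝒜)`: the number of members of `L(𝒜)` of
codimension `k`. -/
noncomputable def whitneySecond {F : Type*} [Field F] {d : ℕ} (𝒜 : Set (Set (Fin d → F)))
    (k : ℕ) : ℕ :=
  {X | X ∈ L 𝒜 ∧ d - dim X = k}.ncard

/-- The regions of an arrangement `ℬ` in the ambient space `X`: the connected components of its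
complement. -/
def regions {d : ℕ} (X : Set (Fin d → ℝ)) (ℬ : Set (Set (Fin d → ℝ))) :
    Set (Set (Fin d → ℝ)) :=
  {C | ∃ x ∈ complement X ℬ, C = connectedComponentIn (complement X ℬ) x}

/-- The number `r(𝒜)` of regions of a real arrangement. -/
noncomputable def regionNumber {d : ℕ} (𝒜 : Set (Set (Fin d → ℝ))) : ℕ∞ :=
  (regions Set.univ 𝒜).encard

/-- The `k`-dimensional faces of a real arrangement: the regions of `𝒜/X` for the
`k`-dimensional `X ∈ L(𝒜)`. -/
def faces {d : ℕ} (𝒜 : Set (Set (Fin d → ℝ))) (k : ℕ) : Set (Set (Fin d → ℝ)) :=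
  {C | ∃ X ∈ L 𝒜, dim X = k ∧ C ∈ regions X (restriction 𝒜 X)}

/-- The number `f_k(𝒜)` of `k`-dimensional faces. -/
noncomputable def faceNumber {d : ℕ} (𝒜 : Set (Set (Fin d → ℝ))) (k : ℕ) : ℕ∞ :=
  (faces 𝒜 k).encard

/-- The induced adjoint arrangement in `F^{d+1}`: the hyperplanes with normals `(v, -1)` for the
`0`-dimensional members `{v}` of `L(𝒜)` and `(u, 0)` for the `1`-dimensional members `F u` of
`L(𝒜ᵒ)`, where `𝒜ᵒ = {H_{β_i,0}}` is the linearization of `𝒜 = {H_{β_i,b_i}}`. -/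
def inducedAdjoint {F : Type*} [Field F] {d m : ℕ} (β : Fin m → Fin d → F) (b : Fin m → F) :
    Set (Set (Fin (d + 1) → F)) :=
  {H | ∃ v : Fin d → F, {v} ∈ L (arrangement β b) ∧
      H = hyperplane (Fin.snoc v (-1) : Fin (d + 1) → F) 0} ∪
  {H | ∃ u : Fin d → F, u ≠ 0 ∧ (Submodule.span F {u} : Set (Fin d → F)) ∈ L (arrangement β 0) ∧
      H = hyperplane (Fin.snoc u 0 : Fin (d + 1) → F) 0}

/-- `X` is the stratum `X_x`: the member `X` of `L(𝒜)` with `x ∈ M(𝒜/X)`. -/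
def IsStratum {V : Type*} (𝒜 : Set (Set V)) (x : V) (X : Set V) : Prop :=
  X ∈ L 𝒜 ∧ x ∈ complement X (restriction 𝒜 X)

end HypArr

/-! Write H and H' for the members added by (α, a) and (α', a'). The inclusion of strata says that
every adjoint hyperplane through (α', a') also passes through (α, a): vertices of 𝒜 on H' lie on H,
and α vanishes on each line of L(𝒜ᵒ) on which α' vanishes. Since 𝒜 is essential, every flat contains
a vertex, and every linear flat on which α is nonzero contains a line of L(𝒜ᵒ) on which α is nonzero
(`exists_vertex`, `exists_line`). Hence a flat of 𝒜 inside H' lies inside H, and a flat that meets H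
without lying in it meets H'. This is `Specializes`, the only relation between the two extensions
used afterwards.

Apart from W_k, which counts flats alone, the invariants count no-broken-circuit (NBC) sets, the
cases with V as a member being settled by convention. By a sign-reversing involution, μ(X, Y) is the
signed number of NBC sets on X that cut out Y (`mobius_eq_sum_nbc`). So c_{ij} counts pairs (X, S)
with dim X = i and S an NBC set on X of size j, and w_k^+ counts those of size k on V. Over ℝ,
deletion and restriction shows that a flat carries as many faces as NBC sets
(`card_signs_eq_card_nbc`), so f_k counts pairs (X, S) with dim X = k.

With the added member last in the order, `Specializes.exists_injection` gives a dimension-preserving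
injection φ on flats. It fixes the old flats, those of 𝒜, and sends a new flat Z ∩ H, where Z is its
old closure, to Z ∩ H'. Every NBC set on X is also one on φ(X), so (X, S) ↦ (φ(X), S) yields the
inequalities. -/

namespace HypArr

/-! ### No-broken-circuit sets -/

section NBC

variable {V ι : Type*} (H : ι → Set V)

/-- The intersection of the members of a family indexed by a finite set. -/
def inter (S : Finset ι) : Set V := {v | ∀ s ∈ S, v ∈ H s}

open Classical in
/-- The indices of the members of the family not containing `X`. -/
noncomputable def free [Fintype ι] (X : Set V) : Finset ι :=
  Finset.univ.filter fun i => ¬ X ⊆ H i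

variable {H}

theorem mem_free [Fintype ι] {X : Set V} {i : ι} : i ∈ free H X ↔ ¬ X ⊆ H i := by
  simp [free]

theorem inter_empty : inter H ∅ = Set.univ := by
  ext; simp [inter]

theorem inter_anti {S T : Finset ι} (h : S ⊆ T) : inter H T ⊆ inter H S :=
  fun _ hv s hs => hv s (h hs)

theorem inter_union [DecidableEq ι] (S T : Finset ι) :
    inter H (S ∪ T) = inter H S ∩ inter H T := by
  ext v
  simp only [inter, Finset.mem_union, Set.mem_ofPred_eq, Set.mem_inter_iff]
  exact ⟨fun h => ⟨fun s hs => h s (.inl hs), fun s hs => h s (.inr hs)⟩,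
    fun h s hs => hs.elim (h.1 s) (h.2 s)⟩

theorem inter_insert [DecidableEq ι] (x : ι) (S : Finset ι) :
    inter H (insert x S) = H x ∩ inter H S := by
  ext v; simp [inter]

theorem subset_inter {X : Set V} {S : Finset ι} : X ⊆ inter H S ↔ ∀ s ∈ S, X ⊆ H s :=
  ⟨fun h s hs _ hv => h hv s hs, fun h _ hv s hs => h s hs hv⟩

theorem inter_congr {H' : ι → Set V} {S : Finset ι} (h : ∀ s ∈ S, H s = H' s) :
    inter H S = inter H' S := by
  ext v
  exact forall₂_congr fun s hs => by rw [h s hs]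

variable [LinearOrder ι] (H)

/-- `S` is a no-broken-circuit set of the family `H` restricted to the ambient set `X` and to the
indices in `I`: it is central, and no member of the family with index below those of a subset
`T` of `S` contains the intersection of `T`. -/
def IsNBC (X : Set V) (I S : Finset ι) : Prop :=
  S ⊆ I ∧ (X ∩ inter H S).Nonempty ∧ ∀ x ∈ I, ¬ X ∩ inter H (S.filter (x < ·)) ⊆ H x

open Classical in
/-- The finite set of no-broken-circuit sets. -/
noncomputable def nbc (X : Set V) (I : Finset ι) : Finset (Finset ι) :=
  I.powerset.filter (IsNBC H X I)

variable {H}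

theorem mem_nbc {X : Set V} {I S : Finset ι} : S ∈ nbc H X I ↔ IsNBC H X I S := by
  simp only [nbc, Finset.mem_filter, Finset.mem_powerset, and_iff_right_iff_imp]
  exact fun h => h.1

theorem IsNBC.mono {X : Set V} {I S T : Finset ι} (h : IsNBC H X I S) (hT : T ⊆ S) :
    IsNBC H X I T := by
  refine ⟨hT.trans h.1, h.2.1.mono (Set.inter_subset_inter_right _ (inter_anti hT)), ?_⟩
  intro x hx hsub
  exact h.2.2 x hx ((Set.inter_subset_inter_right _
    (inter_anti (Finset.filter_subset_filter _ hT))).trans hsub)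

theorem isNBC_empty {X : Set V} {I : Finset ι} (hX : X.Nonempty) (hI : ∀ i ∈ I, ¬ X ⊆ H i) :
    IsNBC H X I ∅ :=
  ⟨Finset.empty_subset _, by simpa [inter_empty] using hX,
    fun x hx => by simpa [inter_empty] using hI x hx⟩

/-- The least index whose member contains `Y` may be added to a no-broken-circuit set whose
intersection contains `Y`. -/
theorem IsNBC.insert_least {X Y : Set V} {I S : Finset ι} (hS : IsNBC H X I S)
    (hY : Y.Nonempty) (hYX : Y ⊆ X) (hYS : Y ⊆ inter H S) {x₀ : ι} (hx₀ : x₀ ∈ I)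
    (hYx : Y ⊆ H x₀) (hmin : ∀ x ∈ I, Y ⊆ H x → x₀ ≤ x) : IsNBC H X I (insert x₀ S) := by
  have hY' : Y ⊆ X ∩ inter H (insert x₀ S) := by
    rw [inter_insert]
    exact Set.subset_inter hYX (Set.subset_inter hYx hYS)
  refine ⟨Finset.insert_subset hx₀ hS.1, hY.mono hY', fun x hx hsub => ?_⟩
  rcases lt_or_ge x x₀ with h | h
  · exact absurd (hmin x hx ((hY'.trans (Set.inter_subset_inter_right _
      (inter_anti (Finset.filter_subset _ _)))).trans hsub)) (not_le.2 h)
  · rw [Finset.filter_insert, if_neg (not_lt.2 h)] at hsub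
    exact hS.2.2 x hx hsub

-- Toggling the least index `x₀` in `I` whose member contains `Y` is a sign-reversing involution:
-- insertion is allowed by `IsNBC.insert_least`, and erasure because the condition passes to
-- subsets.
open Classical in
theorem sum_nbc_eq_zero {X Y : Set V} {I : Finset ι} (hY : Y.Nonempty) (hYX : Y ⊆ X)
    (hI : ∃ i ∈ I, Y ⊆ H i) :
    ∑ S ∈ (nbc H X I).filter (fun S => Y ⊆ inter H S), (-1 : ℤ) ^ S.card = 0 := by
  obtain ⟨x₀, ⟨hx₀, hYx⟩, hmin⟩ : ∃ x₀, (x₀ ∈ I ∧ Y ⊆ H x₀) ∧ ∀ x ∈ I, Y ⊆ H x → x₀ ≤ x := by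
    have hne : (I.filter fun i => Y ⊆ H i).Nonempty := by
      obtain ⟨i, hi⟩ := hI
      exact ⟨i, Finset.mem_filter.2 hi⟩
    refine ⟨_, Finset.mem_filter.1 (Finset.min'_mem _ hne), fun x hx hx' =>
      Finset.min'_le _ _ (Finset.mem_filter.2 ⟨hx, hx'⟩)⟩
  refine Finset.sum_involution (fun S _ => if x₀ ∈ S then S.erase x₀ else insert x₀ S)
    ?_ ?_ ?_ ?_
  · intro S _
    by_cases h : x₀ ∈ S
    · rw [if_pos h, ← Finset.card_erase_add_one h, pow_succ]; ring
    · rw [if_neg h, Finset.card_insert_of_notMem h, pow_succ]; ring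
  · intro S _ _ heq
    by_cases h : x₀ ∈ S
    · rw [if_pos h] at heq
      have hn := Finset.notMem_erase x₀ S
      rw [heq] at hn
      exact hn h
    · rw [if_neg h] at heq
      exact h (heq ▸ Finset.mem_insert_self x₀ S)
  · intro S hS
    rw [Finset.mem_filter, mem_nbc] at hS ⊢
    by_cases h : x₀ ∈ S
    · rw [if_pos h]
      exact ⟨hS.1.mono (Finset.erase_subset _ _),
        hS.2.trans (inter_anti (Finset.erase_subset _ _))⟩
    · rw [if_neg h, inter_insert]
      exact ⟨hS.1.insert_least hY hYX hS.2 hx₀ hYx hmin, Set.subset_inter hYx hS.2⟩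
  · intro S _
    by_cases h : x₀ ∈ S
    · simp [h]
    · simp [h]

theorem filter_lt_insert_of_lt {S : Finset ι} {e x : ι} (hx : x < e) :
    (insert e S).filter (x < ·) = insert e (S.filter (x < ·)) := by
  rw [Finset.filter_insert, if_pos hx]

/-- Adding the largest index to a set amounts to intersecting the ambient set. -/
theorem isNBC_insert_max_insert {X : Set V} {I S : Finset ι} {e : ι} (he : ∀ i ∈ I, i < e)
    (hS : e ∉ S) :
    IsNBC H X (insert e I) (insert e S) ↔ ¬ X ⊆ H e ∧ IsNBC H (X ∩ H e) I S := by
  have key : ∀ T : Finset ι, X ∩ inter H (insert e T) = X ∩ H e ∩ inter H T := fun T => by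
    rw [inter_insert, Set.inter_assoc]
  constructor
  · rintro ⟨h1, h2, h3⟩
    have hSI : S ⊆ I := fun s hs =>
      (Finset.mem_insert.1 (h1 (Finset.mem_insert_of_mem hs))).resolve_left
        (fun h => hS (h ▸ hs))
    refine ⟨fun h => h3 e (Finset.mem_insert_self _ _)
      (Set.inter_subset_left.trans h), hSI, by rwa [← key], fun x hx => ?_⟩
    have := h3 x (Finset.mem_insert_of_mem hx)
    rwa [filter_lt_insert_of_lt (he x hx), key] at this
  · rintro ⟨h0, h1, h2, h3⟩
    refine ⟨Finset.insert_subset_insert _ h1, by rwa [key], fun x hx => ?_⟩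
    rcases Finset.mem_insert.1 hx with rfl | hx
    · have : (insert x S).filter (x < ·) = ∅ := by
        refine Finset.filter_eq_empty_iff.2 fun s hs => ?_
        rcases Finset.mem_insert.1 hs with rfl | hs
        · exact lt_irrefl _
        · exact not_lt.2 (he s (h1 hs)).le
      rw [this, inter_empty, Set.inter_univ]
      exact h0
    · rw [filter_lt_insert_of_lt (he x hx), key]
      exact h3 x hx

theorem isNBC_insert_max {X : Set V} {I S : Finset ι} {e : ι} (he : ∀ i ∈ I, i < e)
    (hS : e ∉ S) :
    IsNBC H X (insert e I) S ↔ ¬ X ⊆ H e ∧ IsNBC H X I S := by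
  have hsub : S ⊆ insert e I ↔ S ⊆ I := Finset.subset_insert_iff_of_notMem hS
  have hfil : S ⊆ I → S.filter (e < ·) = ∅ := fun h =>
    Finset.filter_eq_empty_iff.2 fun s hs => not_lt.2 (he s (h hs)).le
  constructor
  · rintro ⟨h1, h2, h3⟩
    refine ⟨?_, hsub.1 h1, h2, fun x hx => h3 x (Finset.mem_insert_of_mem hx)⟩
    have := h3 e (Finset.mem_insert_self _ _)
    rwa [hfil (hsub.1 h1), inter_empty, Set.inter_univ] at this
  · rintro ⟨h0, h1, h2, h3⟩
    refine ⟨hsub.2 h1, h2, fun x hx => ?_⟩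
    rcases Finset.mem_insert.1 hx with rfl | hx
    · rwa [hfil h1, inter_empty, Set.inter_univ]
    · exact h3 x hx

/-- Deletion and restriction for no-broken-circuit sets. -/
theorem card_nbc_insert_max {X : Set V} {I : Finset ι} {e : ι} (he : ∀ i ∈ I, i < e)
    (hX : ¬ X ⊆ H e) :
    (nbc H X (insert e I)).card = (nbc H X I).card + (nbc H (X ∩ H e) I).card := by
  classical
  have heI : e ∉ I := fun h => lt_irrefl _ (he e h)
  have hnot : ∀ {Y : Set V} {S : Finset ι}, S ∈ nbc H Y I → e ∉ S := fun hS h =>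
    heI ((mem_nbc.1 hS).1 h)
  -- Sets avoiding `e` are NBC for the deletion; sets containing `e` are, after erasing it, NBC for
  -- the restriction to `H e`.
  have : nbc H X (insert e I) = nbc H X I ∪ (nbc H (X ∩ H e) I).image (insert e) := by
    ext S
    rw [Finset.mem_union, Finset.mem_image, mem_nbc, mem_nbc]
    by_cases h : e ∈ S
    · obtain ⟨T, hT, rfl⟩ : ∃ T, e ∉ T ∧ S = insert e T :=
        ⟨S.erase e, Finset.notMem_erase _ _, (Finset.insert_erase h).symm⟩
      rw [isNBC_insert_max_insert he hT]
      constructor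
      · exact fun h => .inr ⟨T, mem_nbc.2 h.2, rfl⟩
      · rintro (h' | ⟨T', hT', heq⟩)
        · exact absurd (h'.1 h) heI
        · have : T' = T := by
            rw [← Finset.erase_insert (hnot hT'), heq, Finset.erase_insert hT]
          exact ⟨hX, this ▸ mem_nbc.1 hT'⟩
    · rw [isNBC_insert_max he h]
      constructor
      · exact fun h => .inl h.2
      · rintro (h' | ⟨T', -, rfl⟩)
        · exact ⟨hX, h'⟩
        · exact absurd (Finset.mem_insert_self _ _) h
  rw [this, Finset.card_union_of_disjoint, Finset.card_image_of_injOn]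
  · intro S hS T hT h
    rw [← Finset.erase_insert (hnot hS), h, Finset.erase_insert (hnot hT)]
  · rw [Finset.disjoint_left]
    rintro S hS hS'
    obtain ⟨T, -, rfl⟩ := Finset.mem_image.1 hS'
    exact hnot hS (Finset.mem_insert_self _ _)

theorem nbc_eq_empty {X : Set V} {I : Finset ι} {i : ι} (hi : i ∈ I) (hX : X ⊆ H i) :
    nbc H X I = ∅ := by
  refine Finset.eq_empty_of_forall_notMem fun S hS => ?_
  exact (mem_nbc.1 hS).2.2 i hi (Set.inter_subset_left.trans hX)

end NBC

end HypArr

namespace HypArr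

/-! ### Affine subspaces and dimension -/

section Affine

variable {F : Type*} [Field F] {d : ℕ}

/-- A set that is the carrier of an affine subspace (possibly empty). -/
def IsAff (X : Set (Fin d → F)) : Prop := ∃ s : AffineSubspace F (Fin d → F), (s : Set _) = X

theorem isAff_univ : IsAff (Set.univ : Set (Fin d → F)) := ⟨⊤, by simp⟩

theorem IsAff.inter {X Y : Set (Fin d → F)} (hX : IsAff X) (hY : IsAff Y) : IsAff (X ∩ Y) := by
  obtain ⟨s, rfl⟩ := hX
  obtain ⟨t, rfl⟩ := hY
  exact ⟨s ⊓ t, rfl⟩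

/-- The hyperplane as an affine subspace. -/
def hyperplaneAff (α : Fin d → F) (a : F) : AffineSubspace F (Fin d → F) where
  carrier := hyperplane α a
  smul_vsub_vadd_mem' := by
    intro c p q r hp hq hr
    simp only [hyperplane, Set.mem_ofPred_eq] at *
    simp [dotProduct_add, dotProduct_sub, hp, hq, hr]

theorem isAff_hyperplane (α : Fin d → F) (a : F) : IsAff (hyperplane α a) :=
  ⟨hyperplaneAff α a, rfl⟩

theorem isAff_inter_family {ι : Type*} {H : ι → Set (Fin d → F)} (hH : ∀ i, IsAff (H i))
    (S : Finset ι) : IsAff (inter H S) := by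
  classical
  induction S using Finset.induction_on with
  | empty => rw [inter_empty]; exact isAff_univ
  | insert x S _ ih => rw [inter_insert]; exact (hH x).inter ih

theorem dim_le (X : Set (Fin d → F)) : dim X ≤ d :=
  (Submodule.finrank_le _).trans (by simp)

theorem dim_univ : dim (Set.univ : Set (Fin d → F)) = d := by
  have h := AffineSubspace.direction_top F (Fin d → F) (Fin d → F)
  rw [AffineSubspace.direction_eq_vectorSpan, AffineSubspace.top_coe] at h
  rw [dim, h]
  simp

theorem IsAff.eq_of_subset_of_dim_eq {X Y : Set (Fin d → F)} (hX : IsAff X) (hY : IsAff Y)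
    (hne : X.Nonempty) (h : X ⊆ Y) (hd : dim X = dim Y) : X = Y := by
  obtain ⟨s, rfl⟩ := hX
  obtain ⟨t, rfl⟩ := hY
  have hle : s ≤ t := h
  have := Submodule.eq_of_le_of_finrank_eq (AffineSubspace.direction_le hle) hd
  rw [AffineSubspace.eq_of_direction_eq_of_nonempty_of_le this hne hle]

theorem finrank_inf_ker_add_one (W : Submodule F (Fin d → F)) (f : (Fin d → F) →ₗ[F] F)
    (h : ¬ W ≤ LinearMap.ker f) :
    Module.finrank F (W ⊓ LinearMap.ker f : Submodule F (Fin d → F)) + 1 =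
      Module.finrank F W := by
  have h1 := LinearMap.finrank_range_add_finrank_ker (f.domRestrict W)
  have h2 : Module.finrank F (LinearMap.range (f.domRestrict W)) = 1 := by
    have : LinearMap.range (f.domRestrict W) = ⊤ := by
      apply LinearMap.range_eq_top.2
      apply LinearMap.surjective
      intro h0
      apply h
      intro w hw
      exact LinearMap.congr_fun h0 ⟨w, hw⟩
    rw [this]; simp
  have h3 : Module.finrank F (LinearMap.ker (f.domRestrict W)) =
      Module.finrank F (W ⊓ LinearMap.ker f : Submodule F (Fin d → F)) := by
    have : W ⊓ LinearMap.ker f = (LinearMap.ker (f.domRestrict W)).map W.subtype := by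
      ext w
      simp
      tauto
    rw [this]
    exact (Submodule.equivMapOfInjective _ W.injective_subtype _).finrank_eq
  omega

/-- Inner product with a fixed vector as a linear form. -/
def dotLin (α : Fin d → F) : (Fin d → F) →ₗ[F] F where
  toFun := fun x => α ⬝ᵥ x
  map_add' := dotProduct_add α
  map_smul' := fun c x => dotProduct_smul c α x

@[simp] theorem dotLin_apply (α x : Fin d → F) : dotLin α x = α ⬝ᵥ x := rfl

theorem mem_hyperplane {α x : Fin d → F} {a : F} : x ∈ hyperplane α a ↔ α ⬝ᵥ x = a := Iff.rfl

theorem direction_hyperplaneAff {α : Fin d → F} {a : F} (h : (hyperplane α a).Nonempty) :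
    (hyperplaneAff α a).direction = LinearMap.ker (dotLin α) := by
  obtain ⟨p, hp⟩ := h
  ext w
  have hp' : p ∈ hyperplaneAff α a := hp
  rw [← AffineSubspace.vadd_mem_iff_mem_direction w hp']
  change α ⬝ᵥ (w + p) = a ↔ α ⬝ᵥ w = 0
  rw [dotProduct_add, mem_hyperplane.1 hp]
  simp

theorem IsAff.dim_inter_hyperplane {X : Set (Fin d → F)} (hX : IsAff X) {α : Fin d → F} {a : F}
    (hne : (X ∩ hyperplane α a).Nonempty) (h : ¬ X ⊆ hyperplane α a) :
    dim (X ∩ hyperplane α a) + 1 = dim X := by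
  obtain ⟨s, rfl⟩ := hX
  obtain ⟨p, hp⟩ := hne
  have h1 : (s ⊓ hyperplaneAff α a : AffineSubspace F (Fin d → F)).direction =
      s.direction ⊓ LinearMap.ker (dotLin α) := by
    rw [AffineSubspace.direction_inf_of_mem hp.1 hp.2, direction_hyperplaneAff ⟨p, hp.2⟩]
  have h2 : ¬ s.direction ≤ LinearMap.ker (dotLin α) := by
    intro hle
    apply h
    intro q hq
    have := hle (AffineSubspace.vsub_mem_direction hq hp.1)
    simp only [vsub_eq_sub, LinearMap.mem_ker, dotLin_apply, dotProduct_sub, sub_eq_zero] at this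
    rw [mem_hyperplane, this]
    exact hp.2
  have h3 := finrank_inf_ker_add_one _ _ h2
  rw [← h1] at h3
  exact h3

/-- A family of sets each of which is the solution set of one affine equation. -/
def IsHypFamily {ι : Type*} (H : ι → Set (Fin d → F)) : Prop :=
  ∀ i, ∃ α a, H i = hyperplane α a

theorem IsHypFamily.isAff {ι : Type*} {H : ι → Set (Fin d → F)} (hH : IsHypFamily H) (i : ι) :
    IsAff (H i) := by
  obtain ⟨α, a, h⟩ := hH i
  rw [h]
  exact isAff_hyperplane α a

theorem IsHypFamily.dim_inter {ι : Type*} {H : ι → Set (Fin d → F)} (hH : IsHypFamily H) (i : ι)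
    {X : Set (Fin d → F)} (hX : IsAff X) (hne : (X ∩ H i).Nonempty) (h : ¬ X ⊆ H i) :
    dim (X ∩ H i) + 1 = dim X := by
  obtain ⟨α, a, hi⟩ := hH i
  rw [hi] at hne h ⊢
  exact hX.dim_inter_hyperplane hne h

/-- Both sections are nonempty of codimension one in `X`, so an inclusion between them is an
equality. -/
theorem inter_eq_of_subset {K L X : Set (Fin d → F)} (hX : IsAff X)
    (hK : ∃ α a, K = hyperplane α a) (hL : ∃ α a, L = hyperplane α a)
    (hne : (X ∩ K).Nonempty) (h1 : ¬ X ⊆ K) (h2 : ¬ X ⊆ L) (h : X ∩ K ⊆ L) :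
    X ∩ K = X ∩ L := by
  have hsub : X ∩ K ⊆ X ∩ L := Set.subset_inter Set.inter_subset_left h
  obtain ⟨α, a, rfl⟩ := hK
  obtain ⟨α', a', rfl⟩ := hL
  refine (hX.inter (isAff_hyperplane _ _)).eq_of_subset_of_dim_eq
    (hX.inter (isAff_hyperplane _ _)) hne hsub ?_
  have h3 := hX.dim_inter_hyperplane hne h1
  have h4 := hX.dim_inter_hyperplane (hne.mono hsub) h2
  omega

/-- NBC sets are independent: when members are intersected in decreasing order of index, each does
not contain the intersection of its predecessors and so lowers the dimension by one. -/
theorem IsNBC.dim_add_card {ι : Type*} [LinearOrder ι] {H : ι → Set (Fin d → F)}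
    (hH : IsHypFamily H) {X : Set (Fin d → F)} (hX : IsAff X) {I : Finset ι} {S : Finset ι}
    (hS : IsNBC H X I S) : dim (X ∩ inter H S) + S.card = dim X := by
  induction S using Finset.induction_on_min with
  | empty => simp [inter_empty]
  | insert x S hx ih =>
    have hS' := ih (hS.mono (Finset.subset_insert _ _))
    have hxS : x ∉ S := fun h => lt_irrefl _ (hx x h)
    have hfil : (insert x S).filter (x < ·) = S := by
      rw [Finset.filter_insert, if_neg (lt_irrefl x)]
      exact Finset.filter_true_of_mem hx
    have h1 := hS.2.2 x (hS.1 (Finset.mem_insert_self _ _))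
    rw [hfil] at h1
    have heq : X ∩ inter H (insert x S) = X ∩ inter H S ∩ H x := by
      rw [inter_insert, Set.inter_comm (H x), Set.inter_assoc]
    have h2 := hH.dim_inter x (hX.inter (isAff_inter_family hH.isAff S))
      (by rw [← heq]; exact hS.2.1) h1
    rw [heq, Finset.card_insert_of_notMem hxS]
    omega

end Affine

end HypArr

namespace HypArr

/-! ### Flats as intersections of finite subfamilies -/

section Flats

variable {V ι : Type*} {H : ι → Set V}

theorem mem_L_range [Finite ι] {X : Set V} :
    X ∈ L (Set.range H) ↔ X.Nonempty ∧ ∃ S : Finset ι, X = inter H S := by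
  refine and_congr_right fun _ => ⟨?_, ?_⟩
  · rintro ⟨ℬ, hℬ, rfl⟩
    refine ⟨(Set.toFinite {i | H i ∈ ℬ}).toFinset, ?_⟩
    ext v
    simp only [Set.mem_sInter, inter, Set.Finite.mem_toFinset, Set.mem_ofPred_eq]
    constructor
    · exact fun h s hs => h _ hs
    · intro h K hK
      obtain ⟨i, rfl⟩ := hℬ hK
      exact h i hK
  · rintro ⟨S, rfl⟩
    refine ⟨H '' S, Set.image_subset_range _ _, ?_⟩
    ext v
    simp [inter]

theorem inter_mem_L [Finite ι] {X : Set V} (hX : X ∈ L (Set.range H)) {S : Finset ι}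
    (hne : (X ∩ inter H S).Nonempty) : X ∩ inter H S ∈ L (Set.range H) := by
  classical
  obtain ⟨-, T, rfl⟩ := mem_L_range.1 hX
  exact mem_L_range.2 ⟨hne, T ∪ S, (inter_union T S).symm⟩

theorem exists_not_subset_of_ssubset [Finite ι] {X Y : Set V}
    (hY : Y ∈ L (Set.range H)) (h : ¬ X ⊆ Y) : ∃ i, ¬ X ⊆ H i ∧ Y ⊆ H i := by
  obtain ⟨-, T, rfl⟩ := mem_L_range.1 hY
  rw [subset_inter] at h
  push Not at h
  obtain ⟨i, hi, hX⟩ := h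
  exact ⟨i, hX, fun v hv => hv i hi⟩

end Flats

/-! ### The Möbius function through NBC sets -/

section Mobius

variable {V ι : Type*}

theorem mobius_self (𝒜 : Set (Set V)) [Finite 𝒜] (X : L 𝒜) : mobius 𝒜 X X = 1 := by
  simp [mobius]

open Classical in
theorem mobius_eq_neg_sum (𝒜 : Set (Set V)) [Finite 𝒜] [Fintype (L 𝒜)] {X Y : L 𝒜}
    (h : Y.1 ⊂ X.1) :
    mobius 𝒜 X Y = - ∑ Z ∈ (Finset.univ : Finset (L 𝒜)).filter
      (fun Z => Z.1 ⊆ X.1 ∧ Y.1 ⊂ Z.1), mobius 𝒜 X Z := by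
  have hne : X ≠ Y := fun h' => h.ne (by rw [h'])
  let _ : Fintype (L 𝒜)ᵒᵈ := Fintype.ofFinite _
  let _ : LocallyFiniteOrder (L 𝒜)ᵒᵈ := Fintype.toLocallyFiniteOrder
  unfold mobius
  rw [IncidenceAlgebra.mu_eq_neg_sum_Ico_of_ne (by simpa using hne)]
  congr 1
  refine Finset.sum_bij (fun Z _ => OrderDual.ofDual Z) ?_ ?_ ?_ ?_
  · intro Z hZ
    rw [Finset.mem_Ico] at hZ
    simp only [Finset.mem_filter, Finset.mem_univ, true_and]
    exact ⟨hZ.1, hZ.2⟩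
  · intro Z _ Z' _ h
    exact h
  · intro Z hZ
    simp only [Finset.mem_filter, Finset.mem_univ, true_and] at hZ
    exact ⟨OrderDual.toDual Z, Finset.mem_Ico.2 ⟨hZ.1, hZ.2⟩, rfl⟩
  · intro Z _
    rfl

variable [LinearOrder ι] [Fintype ι] {H : ι → Set V}

-- The signed counts satisfy the recursion defining the Möbius function: for `Y ≠ X`, their sum over
-- the flats between `X` and `Y` runs over the NBC sets whose intersection contains `Y`, and
-- vanishes by `sum_nbc_eq_zero`.
open Classical in
theorem mobius_eq_sum_nbc (X Y : L (Set.range H)) (hYX : Y.1 ⊆ X.1) :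
    mobius (Set.range H) X Y =
      ∑ S ∈ (nbc H X.1 (free H X.1)).filter (fun S => X.1 ∩ inter H S = Y.1),
        (-1 : ℤ) ^ S.card := by
  let _ : Fintype (L (Set.range H)) := Fintype.ofFinite _
  have hnb : ∀ S ∈ nbc H X.1 (free H X.1), X.1 ∩ inter H S ∈ L (Set.range H) := fun S hS =>
    inter_mem_L X.2 (mem_nbc.1 hS).2.1
  induction Y using (Finite.wellFounded_of_trans_of_irrefl
    (fun A B : L (Set.range H) => B.1 ⊂ A.1)).induction with
  | _ Y ih =>
  by_cases hXY : X = Y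
  · subst hXY
    rw [mobius_self]
    have : (nbc H X.1 (free H X.1)).filter (fun S => X.1 ∩ inter H S = X.1) = {∅} := by
      ext S
      rw [Finset.mem_filter, Finset.mem_singleton, mem_nbc]
      constructor
      · rintro ⟨hS, h⟩
        refine Finset.eq_empty_of_forall_notMem fun i hi => ?_
        exact mem_free.1 (hS.1 hi) (subset_inter.1 (Set.inter_eq_left.1 h) i hi)
      · rintro rfl
        exact ⟨isNBC_empty X.2.1 fun i hi => mem_free.1 hi, by simp [inter_empty]⟩
    rw [this]
    simp
  · have hss : Y.1 ⊂ X.1 := hYX.ssubset_of_ne fun h => hXY (Subtype.ext h.symm)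
    rw [mobius_eq_neg_sum _ hss]
    have hzero : ∑ S ∈ (nbc H X.1 (free H X.1)).filter (fun S => Y.1 ⊆ inter H S),
        (-1 : ℤ) ^ S.card = 0 := by
      refine sum_nbc_eq_zero Y.2.1 hYX ?_
      obtain ⟨i, hi, hi'⟩ := exists_not_subset_of_ssubset Y.2 hss.2
      exact ⟨i, mem_free.2 hi, hi'⟩
    have hfib : ∑ Z ∈ (Finset.univ : Finset (L (Set.range H))).filter
          (fun Z => Z.1 ⊆ X.1 ∧ Y.1 ⊆ Z.1),
        ∑ S ∈ (nbc H X.1 (free H X.1)).filter (fun S => X.1 ∩ inter H S = Z.1),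
          (-1 : ℤ) ^ S.card = 0 := by
      rw [← hzero]
      simp_rw [Finset.sum_filter]
      rw [← Finset.sum_filter, Finset.sum_comm]
      refine Finset.sum_congr rfl fun S hS => ?_
      by_cases hYS : Y.1 ⊆ inter H S
      · rw [if_pos hYS, Finset.sum_eq_single ⟨_, hnb S hS⟩]
        · simp
        · intro Z _ hZ
          exact if_neg fun h => hZ (Subtype.ext h.symm)
        · intro h
          refine absurd ?_ h
          simp only [Finset.mem_filter, Finset.mem_univ, true_and]
          exact ⟨Set.inter_subset_left, Set.subset_inter hYX hYS⟩
      · rw [if_neg hYS]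
        refine Finset.sum_eq_zero fun Z hZ => if_neg fun h => hYS ?_
        simp only [Finset.mem_filter, Finset.mem_univ, true_and] at hZ
        exact (hZ.2.trans h.ge).trans Set.inter_subset_right
    have hsplit : (Finset.univ : Finset (L (Set.range H))).filter
          (fun Z => Z.1 ⊆ X.1 ∧ Y.1 ⊆ Z.1) =
        insert Y ((Finset.univ : Finset (L (Set.range H))).filter
          (fun Z => Z.1 ⊆ X.1 ∧ Y.1 ⊂ Z.1)) := by
      ext Z
      simp only [Finset.mem_filter, Finset.mem_univ, true_and, Finset.mem_insert]
      constructor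
      · rintro ⟨h1, h2⟩
        by_cases h : Z = Y
        · exact .inl h
        · exact .inr ⟨h1, h2.ssubset_of_ne fun h' => h (Subtype.ext h'.symm)⟩
      · rintro (rfl | ⟨h1, h2⟩)
        · exact ⟨hYX, subset_rfl⟩
        · exact ⟨h1, h2.1⟩
    rw [hsplit, Finset.sum_insert (by simp)] at hfib
    rw [Finset.sum_congr rfl (fun Z hZ => ih Z (Finset.mem_filter.1 hZ).2.2
      (Finset.mem_filter.1 hZ).2.1)]
    linarith

end Mobius

end HypArr

namespace HypArr

/-! ### Old flats and old closures -/

section OldFlats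

variable {V ι : Type*}

/-- The flats that are intersections of members with index different from `e`. -/
def IsOld (H : ι → Set V) (e : ι) (X : Set V) : Prop :=
  X.Nonempty ∧ ∃ S : Finset ι, e ∉ S ∧ X = inter H S

variable {H : ι → Set V} {e : ι}

theorem IsOld.inter {X : Set V} (hX : IsOld H e X) {S : Finset ι} (hS : e ∉ S)
    (hne : (X ∩ inter H S).Nonempty) : IsOld H e (X ∩ inter H S) := by
  classical
  obtain ⟨-, T, hT, rfl⟩ := hX
  exact ⟨hne, T ∪ S, by simp [hT, hS], (inter_union T S).symm⟩

theorem IsOld.inter_single {X : Set V} (hX : IsOld H e X) {i : ι} (hi : i ≠ e)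
    (hne : (X ∩ H i).Nonempty) : IsOld H e (X ∩ H i) := by
  have h : HypArr.inter H {i} = H i := by ext; simp [HypArr.inter]
  rw [← h] at hne ⊢
  exact hX.inter (by simpa using hi.symm) hne

theorem IsOld.mem_L [Fintype ι] {X : Set V} (hX : IsOld H e X) :
    X ∈ L (Set.range H) := by
  obtain ⟨h, T, -, rfl⟩ := hX
  exact mem_L_range.2 ⟨h, T, rfl⟩

open Classical in
/-- The smallest intersection of members with index different from `e` containing `X`. -/
noncomputable def oldClosure [Fintype ι] (H : ι → Set V) (e : ι)
    (X : Set V) : Set V :=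
  inter H (Finset.univ.filter fun i => i ≠ e ∧ X ⊆ H i)

open Classical in
theorem subset_oldClosure [Fintype ι] (X : Set V) : X ⊆ oldClosure H e X :=
  subset_inter.2 fun _ hs => (Finset.mem_filter.1 hs).2.2

open Classical in
theorem oldClosure_subset [Fintype ι] {X : Set V} {i : ι} (hi : i ≠ e) (hX : X ⊆ H i) :
    oldClosure H e X ⊆ H i :=
  fun _ hv => hv i (Finset.mem_filter.2 ⟨Finset.mem_univ _, hi, hX⟩)

theorem isOld_oldClosure [Fintype ι] {X : Set V} (hX : X.Nonempty) :
    IsOld H e (oldClosure H e X) :=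
  ⟨hX.mono (subset_oldClosure X), _, by simp, rfl⟩

theorem oldClosure_congr [Fintype ι] {X Y : Set V}
    (h : ∀ i, i ≠ e → (X ⊆ H i ↔ Y ⊆ H i)) : oldClosure H e X = oldClosure H e Y := by
  unfold oldClosure
  congr 1
  ext i
  simp only [Finset.mem_filter, Finset.mem_univ, true_and]
  exact and_congr_right (h i)

/-- A new flat must use the index `e`, and all its other members already contain the old closure. -/
theorem oldClosure_inter_eq [Fintype ι] {X : Set V} (hX : X ∈ L (Set.range H))
    (hnew : ¬ IsOld H e X) : oldClosure H e X ∩ H e = X := by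
  obtain ⟨hne, S, hS⟩ := mem_L_range.1 hX
  have he : e ∈ S := by
    by_contra he
    exact hnew ⟨hne, S, he, hS⟩
  refine subset_antisymm ?_ (Set.subset_inter (subset_oldClosure X) ?_)
  · rintro v ⟨hv, hve⟩
    rw [hS]
    intro s hs
    by_cases hse : s = e
    · rwa [hse]
    · exact oldClosure_subset hse (hS ▸ fun w hw => hw s hs) hv
  · rw [hS]
    exact fun w hw => hw e he

theorem not_oldClosure_subset [Fintype ι] {X : Set V} (hX : X ∈ L (Set.range H))
    (hnew : ¬ IsOld H e X) : ¬ oldClosure H e X ⊆ H e := by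
  intro hsub
  have := oldClosure_inter_eq hX hnew
  rw [Set.inter_eq_left.2 hsub] at this
  exact hnew (this ▸ isOld_oldClosure hX.1)

end OldFlats

/-! ### Specialization of the last member -/

section Specialization

variable {F : Type*} [Field F] {d : ℕ}

theorem IsOld.isAff {ι : Type*} {H : ι → Set (Fin d → F)} {e : ι} {X : Set (Fin d → F)}
    (hX : IsOld H e X) (hH : IsHypFamily H) : IsAff X := by
  obtain ⟨-, T, -, rfl⟩ := hX
  exact isAff_inter_family hH.isAff T

variable {ι : Type*} [LinearOrder ι]

/-- The families `H` and `H'` differ only at the largest index `e`, and `H e` is in a more special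
position than `H' e` with respect to the other members. -/
structure Specializes (H H' : ι → Set (Fin d → F)) (e : ι) : Prop where
  le_top : ∀ i, i ≤ e
  hyp : IsHypFamily H
  hyp' : IsHypFamily H'
  eq_of_ne : ∀ i, i ≠ e → H i = H' i
  subset : ∀ S, e ∉ S → (inter H S).Nonempty → inter H S ⊆ H' e → inter H S ⊆ H e
  nonempty : ∀ S, e ∉ S → (inter H S ∩ H e).Nonempty → ¬ inter H S ⊆ H e →
    (inter H S ∩ H' e).Nonempty

variable {H H' : ι → Set (Fin d → F)} {e : ι}

namespace Specializes

theorem lt_of_ne (h : Specializes H H' e) {i : ι} (hi : i ≠ e) : i < e :=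
  lt_of_le_of_ne (h.le_top i) hi

theorem inter_eq (h : Specializes H H' e) {S : Finset ι} (hS : e ∉ S) : inter H S = inter H' S :=
  inter_congr fun s hs => h.eq_of_ne s fun he => hS (he ▸ hs)

theorem isOld (h : Specializes H H' e) {X : Set (Fin d → F)}
    (hX : IsOld H e X) : IsOld H' e X := by
  obtain ⟨h1, T, hT, rfl⟩ := hX
  exact ⟨h1, T, hT, h.inter_eq hT⟩

theorem univ_mem (h : Specializes H H' e) (hu : Set.univ ∈ Set.range H') :
    Set.univ ∈ Set.range H := by
  obtain ⟨i, hi⟩ := hu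
  by_cases hie : i = e
  · subst hie
    refine ⟨i, Set.eq_univ_of_univ_subset ?_⟩
    have := h.subset ∅ (by simp) (by simp [inter_empty])
    rw [inter_empty, hi] at this
    exact this subset_rfl
  · exact ⟨i, (h.eq_of_ne i hie).trans hi⟩

theorem subset_of_isOld (h : Specializes H H' e) {X : Set (Fin d → F)}
    (hX : IsOld H e X) (hX' : X ⊆ H' e) : X ⊆ H e := by
  obtain ⟨h1, T, hT, rfl⟩ := hX
  exact h.subset T hT h1 hX'

theorem nonempty_of_isOld (h : Specializes H H' e) {X : Set (Fin d → F)}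
    (hX : IsOld H e X) (hne : (X ∩ H e).Nonempty)
    (hX' : ¬ X ⊆ H e) : (X ∩ H' e).Nonempty := by
  obtain ⟨h1, T, hT, rfl⟩ := hX
  exact h.nonempty T hT hne hX'

/-- If `Y ∩ H' e` lay in `H x`, it would equal `Y ∩ H x` by dimension. That flat is old and lies in
`H' e`, hence in `H e`, so it would also equal `Y ∩ H e`, against `hYx`. -/
theorem not_inter_subset (h : Specializes H H' e) {Y : Set (Fin d → F)}
    (hY : IsOld H e Y) (hYe : ¬ Y ⊆ H e)
    (hne : (Y ∩ H e).Nonempty) {x : ι} (hx : x ≠ e) (hYx : ¬ Y ∩ H e ⊆ H x) :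
    ¬ Y ∩ H' e ⊆ H x := by
  intro hsub
  have haff := hY.isAff h.hyp
  have hne' := h.nonempty_of_isOld hY hne hYe
  have hYe' : ¬ Y ⊆ H' e := fun h' => hYe (h.subset_of_isOld hY h')
  have hYx' : ¬ Y ⊆ H x := fun h' => hYx (Set.inter_subset_left.trans h')
  have heq := inter_eq_of_subset haff (h.hyp' e) (h.hyp x) hne' hYe' hYx' hsub
  have hold : IsOld H e (Y ∩ H x) := hY.inter_single hx (heq ▸ hne')
  have hsub' : Y ∩ H x ⊆ H e := h.subset_of_isOld hold (heq ▸ Set.inter_subset_right)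
  have heq' := inter_eq_of_subset haff (h.hyp x) (h.hyp e) hold.1 hYx' hYe hsub'
  exact hYx (heq' ▸ Set.inter_subset_right)

/-- Conditions not involving `e` are the same for both families. If `e ∈ S`, the indices of `S`
other than `e` cut out old flats meeting `H e` properly, so centrality follows from
`nonempty_of_isOld` and the remaining conditions from `not_inter_subset`. -/
theorem isNBC_of_isOld (h : Specializes H H' e) [Fintype ι] {X : Set (Fin d → F)}
    (hX : IsOld H e X) {S : Finset ι}
    (hS : IsNBC H X (free H X) S) : IsNBC H' X (free H' X) S := by
  -- As `e` is the largest index, the condition at `e` involves no element of `S` and only says that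
  -- `X` is not contained in `H' e`.
  have hfilt : ∀ T : Finset ι, T.filter (e < ·) = ∅ := fun T =>
    Finset.filter_eq_empty_iff.2 fun s _ => not_lt.2 (h.le_top s)
  have htop : e ∈ free H' X → ¬ X ∩ inter H' (S.filter (e < ·)) ⊆ H' e := fun he => by
    rw [hfilt, inter_empty, Set.inter_univ]
    exact mem_free.1 he
  have hfree : ∀ i ∈ S, i ∈ free H' X := fun i hi => by
    have := mem_free.1 (hS.1 hi)
    rw [mem_free]
    by_cases hie : i = e
    · subst hie
      exact fun h' => this (h.subset_of_isOld hX h')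
    · rwa [← h.eq_of_ne i hie]
  have hfree' : ∀ i ∈ free H' X, i ≠ e → i ∈ free H X := fun i hi hie => by
    rw [mem_free] at hi ⊢
    rwa [h.eq_of_ne i hie]
  by_cases he : e ∈ S
  · obtain ⟨T, hT, rfl⟩ : ∃ T, e ∉ T ∧ S = insert e T :=
      ⟨S.erase e, Finset.notMem_erase _ _, (Finset.insert_erase he).symm⟩
    have hcut : ∀ U : Finset ι, X ∩ inter H (insert e U) = X ∩ inter H U ∩ H e := fun U => by
      rw [inter_insert, Set.inter_comm (H e), Set.inter_assoc]
    have hcut' : ∀ U : Finset ι, e ∉ U → X ∩ inter H' (insert e U) = X ∩ inter H U ∩ H' e :=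
      fun U hU => by
        rw [inter_insert, Set.inter_comm (H' e), Set.inter_assoc, h.inter_eq hU]
    have hXT : ∀ U ⊆ T, (X ∩ inter H U ∩ H e).Nonempty ∧ IsOld H e (X ∩ inter H U) ∧
        ¬ X ∩ inter H U ⊆ H e := fun U hU => by
      have heU : e ∉ U := fun h' => hT (hU h')
      have h1 := hS.mono (Finset.insert_subset_insert e hU)
      have h2 := h1.mono (Finset.subset_insert e U)
      have h3 := h1.2.1
      rw [hcut] at h3
      refine ⟨h3, hX.inter heU (h3.mono Set.inter_subset_left), fun hsub => ?_⟩
      -- Were this old flat inside `H e`, adding `e` would increase the cardinality without lowering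
      -- the dimension.
      have d1 := h1.dim_add_card h.hyp (hX.isAff h.hyp)
      have d2 := h2.dim_add_card h.hyp (hX.isAff h.hyp)
      rw [hcut, Set.inter_eq_left.2 hsub, Finset.card_insert_of_notMem heU] at d1
      omega
    refine ⟨hfree, ?_, fun x hx => ?_⟩
    · obtain ⟨h1, h2, h3⟩ := hXT T subset_rfl
      rw [hcut' T hT]
      exact h.nonempty_of_isOld h2 h1 h3
    · by_cases hxe : x = e
      · subst hxe
        exact htop hx
      · have hTx := hS.2.2 x (hfree' x hx hxe)
        have hxlt := h.lt_of_ne hxe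
        have hmem : e ∉ T.filter (x < ·) := fun h' => hT (Finset.mem_filter.1 h').1
        rw [filter_lt_insert_of_lt hxlt, hcut] at hTx
        rw [filter_lt_insert_of_lt hxlt, hcut' _ hmem, ← h.eq_of_ne x hxe]
        obtain ⟨h1, h2, h3⟩ := hXT _ (Finset.filter_subset (x < ·) T)
        exact h.not_inter_subset h2 h3 h1 hxe hTx
  · refine ⟨hfree, ?_, fun x hx => ?_⟩
    · rw [← h.inter_eq he]
      exact hS.2.1
    · by_cases hxe : x = e
      · subst hxe
        exact htop hx
      · rw [← h.inter_eq (fun h' => he (Finset.mem_filter.1 h').1), ← h.eq_of_ne x hxe]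
        exact hS.2.2 x (hfree' x hx hxe)

end Specializes

/-! ### Images of the new flats and the injection -/

namespace Specializes

variable [Fintype ι] {X : Set (Fin d → F)}

theorem oldClosure_inter_nonempty (h : Specializes H H' e) (hX : X ∈ L (Set.range H))
    (hnew : ¬ IsOld H e X) : (oldClosure H e X ∩ H' e).Nonempty :=
  h.nonempty_of_isOld (isOld_oldClosure hX.1) ((oldClosure_inter_eq hX hnew).symm ▸ hX.1)
    (not_oldClosure_subset hX hnew)

theorem dim_oldClosure_inter (h : Specializes H H' e) (hX : X ∈ L (Set.range H))
    (hnew : ¬ IsOld H e X) : dim (oldClosure H e X ∩ H' e) = dim X := by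
  have hold : IsOld H e (oldClosure H e X) := isOld_oldClosure hX.1
  have haff := hold.isAff h.hyp
  have hsub := not_oldClosure_subset hX hnew
  have heq := oldClosure_inter_eq hX hnew
  have h1 := h.hyp.dim_inter e haff (heq.symm ▸ hX.1) hsub
  have h2 := h.hyp'.dim_inter e haff (h.oldClosure_inter_nonempty hX hnew)
    fun h' => hsub (h.subset_of_isOld hold h')
  rw [heq] at h1
  omega

/-- An old flat inside `H' e` lies in `H e`, so the image would be contained in `X`; equal
dimensions would make it `X`, which is new. Thus images of old and new flats never coincide. -/
theorem not_isOld_oldClosure_inter (h : Specializes H H' e) (hX : X ∈ L (Set.range H))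
    (hnew : ¬ IsOld H e X) : ¬ IsOld H e (oldClosure H e X ∩ H' e) := by
  intro hold
  have heq := oldClosure_inter_eq hX hnew
  have hsub : oldClosure H e X ∩ H' e ⊆ X := by
    refine Set.Subset.trans ?_ heq.subset
    exact Set.subset_inter Set.inter_subset_left
      (h.subset_of_isOld hold Set.inter_subset_right)
  have hXaff : IsAff X := by
    rw [← heq]
    exact ((isOld_oldClosure hX.1).isAff h.hyp).inter (h.hyp.isAff e)
  have := (hold.isAff h.hyp).eq_of_subset_of_dim_eq hXaff hold.1 hsub
    (h.dim_oldClosure_inter hX hnew)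
  exact hnew (this ▸ hold)

/-- If the image lay in `H i` and `X` did not, the image would equal the section of the old closure
by `H i`, an old flat. -/
theorem oldClosure_inter_subset_iff (h : Specializes H H' e) (hX : X ∈ L (Set.range H))
    (hnew : ¬ IsOld H e X) {i : ι} (hi : i ≠ e) :
    oldClosure H e X ∩ H' e ⊆ H i ↔ X ⊆ H i := by
  have hold : IsOld H e (oldClosure H e X) := isOld_oldClosure hX.1
  constructor
  · intro hsub
    by_contra hXi
    have h1 : ¬ oldClosure H e X ⊆ H i := fun h' => hXi ((subset_oldClosure X).trans h')
    have h2 : ¬ oldClosure H e X ⊆ H' e := fun h' =>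
      not_oldClosure_subset hX hnew (h.subset_of_isOld hold h')
    have hne := h.oldClosure_inter_nonempty hX hnew
    have heq := inter_eq_of_subset (hold.isAff h.hyp) (h.hyp' e) (h.hyp i) hne h2 h1 hsub
    apply h.not_isOld_oldClosure_inter hX hnew
    rw [heq] at hne ⊢
    exact hold.inter_single hi hne
  · exact fun h' => Set.inter_subset_left.trans (oldClosure_subset hi h')

/-- A new flat can be recovered from its image through the old closure, which gives injectivity. -/
theorem oldClosure_oldClosure_inter (h : Specializes H H' e) (hX : X ∈ L (Set.range H))
    (hnew : ¬ IsOld H e X) :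
    oldClosure H e (oldClosure H e X ∩ H' e) = oldClosure H e X :=
  oldClosure_congr fun _ hi => h.oldClosure_inter_subset_iff hX hnew hi

/-- Inserting `e` turns an NBC set on a new flat into one on its old closure. There `isNBC_of_isOld`
applies, and removing `e` again leaves an NBC set on the section by `H' e`. -/
theorem isNBC_of_new (h : Specializes H H' e) (hX : X ∈ L (Set.range H))
    (hnew : ¬ IsOld H e X) {S : Finset ι}
    (hS : IsNBC H X (free H X) S) :
    IsNBC H' (oldClosure H e X ∩ H' e) (free H' (oldClosure H e X ∩ H' e)) S := by
  have hold : IsOld H e (oldClosure H e X) := isOld_oldClosure hX.1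
  have heq := oldClosure_inter_eq hX hnew
  have hsub := not_oldClosure_subset hX hnew
  have hXe : X ⊆ H e := heq ▸ Set.inter_subset_right
  have hlt : ∀ i ∈ free H X, i < e := fun i hi => h.lt_of_ne fun hie =>
    mem_free.1 hi (hie ▸ hXe)
  have heS : e ∉ S := fun he => lt_irrefl _ (hlt e (hS.1 he))
  have hfree : free H (oldClosure H e X) = insert e (free H X) := by
    ext i
    rw [Finset.mem_insert, mem_free, mem_free]
    by_cases hi : i = e
    · subst hi
      simp [hsub]
    · simp only [hi, false_or, not_iff_not]
      exact ⟨fun h' => (subset_oldClosure X).trans h', oldClosure_subset hi⟩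
  have hsub' : ¬ oldClosure H e X ⊆ H' e := fun h' => hsub (h.subset_of_isOld hold h')
  have hfree₁ : free H' (oldClosure H e X ∩ H' e) = free H X := by
    ext i
    rw [mem_free, mem_free, not_iff_not]
    by_cases hi : i = e
    · subst hi
      exact ⟨fun _ => hXe, fun _ => Set.inter_subset_right⟩
    · rw [← h.eq_of_ne i hi]
      exact h.oldClosure_inter_subset_iff hX hnew hi
  have hfree₂ : free H' (oldClosure H e X) = insert e (free H X) := by
    rw [← hfree]
    ext i
    rw [mem_free, mem_free, not_iff_not]
    by_cases hi : i = e
    · subst hi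
      exact ⟨fun h' => absurd h' hsub', fun h' => absurd h' hsub⟩
    · rw [h.eq_of_ne i hi]
  have h1 : IsNBC H (oldClosure H e X) (free H (oldClosure H e X)) (insert e S) := by
    rw [hfree, isNBC_insert_max_insert hlt heS, heq]
    exact ⟨hsub, hS⟩
  have h2 := h.isNBC_of_isOld hold h1
  rw [hfree₂, isNBC_insert_max_insert hlt heS] at h2
  rw [hfree₁]
  exact h2.2

/-- Under specialization the flats inject into those of the more general family, preserving the
dimension and no-broken-circuit sets. -/
theorem exists_injection (h : Specializes H H' e) : ∃ φ : Set (Fin d → F) → Set (Fin d → F),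
    Set.MapsTo φ (L (Set.range H)) (L (Set.range H')) ∧ Set.InjOn φ (L (Set.range H)) ∧
    (∀ X ∈ L (Set.range H), dim (φ X) = dim X) ∧
    (∀ X ∈ L (Set.range H), ∀ S, IsNBC H X (free H X) S →
      IsNBC H' (φ X) (free H' (φ X)) S) ∧ φ Set.univ = Set.univ := by
  classical
  have huniv : IsOld H e Set.univ := ⟨Set.univ_nonempty, ∅, by simp, inter_empty.symm⟩
  refine ⟨fun X => if IsOld H e X then X else oldClosure H e X ∩ H' e, ?_, ?_, ?_, ?_, ?_⟩
  · intro X hX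
    by_cases hold : IsOld H e X
    · simp only [if_pos hold]
      exact (h.isOld hold).mem_L
    · simp only [if_neg hold]
      obtain ⟨-, S, hS, heq⟩ := h.isOld (isOld_oldClosure (H := H) (e := e) hX.1)
      refine mem_L_range.2 ⟨h.oldClosure_inter_nonempty hX hold, insert e S, ?_⟩
      rw [inter_insert, heq, Set.inter_comm]
  · intro X hX Y hY hXY
    by_cases hXo : IsOld H e X <;> by_cases hYo : IsOld H e Y
    · simpa only [if_pos hXo, if_pos hYo] using hXY
    · simp only [if_pos hXo, if_neg hYo] at hXY
      exact absurd (hXY ▸ hXo) (h.not_isOld_oldClosure_inter hY hYo)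
    · simp only [if_neg hXo, if_pos hYo] at hXY
      exact absurd (hXY.symm ▸ hYo) (h.not_isOld_oldClosure_inter hX hXo)
    · simp only [if_neg hXo, if_neg hYo] at hXY
      have := congrArg (oldClosure H e) hXY
      rw [h.oldClosure_oldClosure_inter hX hXo, h.oldClosure_oldClosure_inter hY hYo] at this
      rw [← oldClosure_inter_eq hX hXo, this, oldClosure_inter_eq hY hYo]
  · intro X hX
    by_cases hold : IsOld H e X
    · simp only [if_pos hold]
    · simp only [if_neg hold]
      exact h.dim_oldClosure_inter hX hold
  · intro X hX S hS
    by_cases hold : IsOld H e X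
    · simp only [if_pos hold]
      exact h.isNBC_of_isOld hold hS
    · simp only [if_neg hold]
      exact h.isNBC_of_new hX hold hS
  · simp only [if_pos huniv]

end Specializes

end Specialization

end HypArr

namespace HypArr

/-! ### Whitney numbers as counts of pairs -/

section Counting

variable {V ι : Type*}

-- Turns sums over flats into sizes of sets of pairs, on which the injection acts directly.
open Classical in
theorem ncard_flat_pairs (H : ι → Set V) [Fintype (L (Set.range H))] (P : Set V → Prop)
    (T : Set V → Finset (Finset ι)) :
    {q : Set V × Finset ι | q.1 ∈ L (Set.range H) ∧ P q.1 ∧ q.2 ∈ T q.1}.ncard =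
      ∑ X ∈ (Finset.univ : Finset (L (Set.range H))).filter (fun X => P X.1), (T X.1).card := by
  rw [← Finset.card_sigma, ← Set.ncard_coe_finset,
    ← Set.ncard_image_of_injective _
      (f := fun q : (_ : L (Set.range H)) × Finset ι => (q.1.1, q.2))]
  · congr 1
    ext ⟨X, S⟩
    simp only [Set.mem_ofPred_eq, Set.mem_image, Finset.coe_sigma, Set.mem_sigma_iff,
      Finset.mem_coe, Finset.mem_filter, Finset.mem_univ, true_and, Prod.mk.injEq]
    constructor
    · rintro ⟨h1, h2, h3⟩
      exact ⟨⟨⟨X, h1⟩, S⟩, ⟨h2, h3⟩, rfl, rfl⟩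
    · rintro ⟨⟨X', S'⟩, ⟨h2, h3⟩, rfl, rfl⟩
      exact ⟨X'.2, h2, h3⟩
  · rintro ⟨⟨X, hX⟩, S⟩ ⟨⟨X', hX'⟩, S'⟩ h
    simp only [Prod.mk.injEq] at h
    obtain ⟨rfl, rfl⟩ := h
    rfl

theorem eq_neg_one_pow_mul_mul (k : ℕ) (x : ℤ) : x = (-1) ^ k * ((-1) ^ k * x) := by
  rw [← mul_assoc, ← mul_pow]
  simp

end Counting

section WhitneyNumbers

variable {F : Type*} [Field F] {d : ℕ} {ι : Type*} [Fintype ι] {H : ι → Set (Fin d → F)}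

theorem isAff_of_mem_L (hH : IsHypFamily H) {X : Set (Fin d → F)} (hX : X ∈ L (Set.range H)) :
    IsAff X := by
  obtain ⟨-, S, rfl⟩ := mem_L_range.1 hX
  exact isAff_inter_family hH.isAff S

variable [LinearOrder ι]

-- An NBC set of size `j` on `X` cuts out a flat of dimension `dim X - j`, so a fixed dimension of
-- `Y` fixes the sign of every contribution.
open Classical in
theorem sum_mobius_of_dim [Fintype (L (Set.range H))] (hH : IsHypFamily H)
    (X : L (Set.range H)) {j : ℕ} (hj : j ≤ dim X.1) :
    ∑ Y ∈ (Finset.univ : Finset (L (Set.range H))).filter (fun Y => Y.1 ⊆ X.1),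
      (if dim X.1 - j = dim Y.1 then mobius (Set.range H) X Y else 0) =
    (-1) ^ j * (((nbc H X.1 (free H X.1)).filter (fun S => S.card = j)).card : ℤ) := by
  rw [Finset.sum_congr rfl (g := fun Y => ∑ S ∈ nbc H X.1 (free H X.1),
    if X.1 ∩ inter H S = Y.1 then (if S.card = j then (-1 : ℤ) ^ j else 0) else 0)]
  · rw [Finset.sum_comm, Finset.card_filter, Nat.cast_sum, Finset.mul_sum]
    refine Finset.sum_congr rfl fun S hS => ?_
    rw [Finset.sum_eq_single ⟨_, inter_mem_L X.2 (mem_nbc.1 hS).2.1⟩]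
    · simp
    · intro Z _ hZ
      exact if_neg fun h => hZ (Subtype.ext h.symm)
    · intro h
      refine absurd (Finset.mem_filter.2 ⟨Finset.mem_univ _, ?_⟩) h
      exact Set.inter_subset_left
  · intro Y hY
    rw [mobius_eq_sum_nbc X Y (Finset.mem_filter.1 hY).2, Finset.sum_filter]
    have hcard : ∀ S ∈ nbc H X.1 (free H X.1), X.1 ∩ inter H S = Y.1 →
        dim Y.1 + S.card = dim X.1 := fun S hS hSY =>
      hSY ▸ (mem_nbc.1 hS).dim_add_card hH (isAff_of_mem_L hH X.2)
    split_ifs with h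
    · refine Finset.sum_congr rfl fun S hS => ?_
      split_ifs with h1 h2
      · rw [h2]
      · have := hcard S hS h1
        omega
      · rfl
    · refine (Finset.sum_eq_zero fun S hS => ?_).symm
      split_ifs with h1 _
      · have := hcard S hS h1
        omega
      · rfl
      · rfl

theorem whitneyCoeff_eq_ncard {𝒜 : Set (Set (Fin d → F))} [Finite 𝒜] (h𝒜 : 𝒜 = Set.range H)
    (hH : IsHypFamily H) (hu : Set.univ ∉ 𝒜) {i j : ℕ} (hj : j ≤ i) (hi : i ≤ d) :
    whitneyCoeff 𝒜 i j = ({q : Set (Fin d → F) × Finset ι | q.1 ∈ L (Set.range H) ∧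
      dim q.1 = i ∧ q.2 ∈ (nbc H q.1 (free H q.1)).filter (fun S => S.card = j)}.ncard : ℤ) := by
  classical
  subst h𝒜
  let _ : Fintype (L (Set.range H)) := Fintype.ofFinite _
  rw [ncard_flat_pairs H (fun X => dim X = i)
    (fun X => (nbc H X (free H X)).filter (fun S => S.card = j))]
  unfold whitneyCoeff whitneyPoly
  rw [if_neg hu]
  simp only [Polynomial.finsetSum_coeff, Polynomial.coeff_C_mul_X_pow]
  rw [Nat.cast_sum, Finset.sum_filter, Finset.mul_sum]
  refine Finset.sum_congr rfl fun X _ => ?_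
  -- Together with `i ≤ d`, this makes the truncated equation `d - i = d - dim X` equivalent to `dim
  -- X = i`.
  have hXd := dim_le X.1
  by_cases hX : dim X.1 = i
  · rw [if_pos hX]
    have := sum_mobius_of_dim hH X (hX ▸ hj : j ≤ dim X.1)
    rw [hX] at this
    rw [eq_neg_one_pow_mul_mul j (Nat.cast _), ← this]
    refine congrArg _ (Finset.sum_congr rfl fun Y _ => ?_)
    rw [if_pos (by rw [hX]), Polynomial.coeff_C_mul_X_pow]
  · rw [if_neg hX, Finset.sum_eq_zero, mul_zero]
    intro Y _
    rw [if_neg (by omega), Polynomial.coeff_zero]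

theorem whitneyFirst_eq_card {𝒜 : Set (Set (Fin d → F))} [Finite 𝒜] (h𝒜 : 𝒜 = Set.range H)
    (hH : IsHypFamily H) (hu : Set.univ ∉ 𝒜) {k : ℕ} (hk : k ≤ d) :
    whitneyFirst 𝒜 k = (((nbc H Set.univ (free H Set.univ)).filter
      (fun S => S.card = k)).card : ℤ) := by
  classical
  subst h𝒜
  let _ : Fintype (L (Set.range H)) := Fintype.ofFinite _
  have := sum_mobius_of_dim hH ⟨Set.univ, Set.univ_nonempty, ∅, Set.empty_subset _, by simp⟩
    (j := k) (by rw [dim_univ]; exact hk)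
  simp only [dim_univ] at this
  unfold whitneyFirst charPoly
  rw [if_neg hu]
  simp only [Polynomial.finsetSum_coeff, Polynomial.coeff_C_mul_X_pow]
  rw [eq_neg_one_pow_mul_mul k (Nat.cast _)]
  refine congrArg _ (Eq.trans ?_ this)
  refine Finset.sum_congr ?_ fun _ _ => rfl
  ext Y
  simp

variable {H' : ι → Set (Fin d → F)} {e : ι}

namespace Specializes

theorem ncard_pairs_le (h : Specializes H H' e) (i : ℕ) (p : Finset ι → Prop)
    [DecidablePred p] :
    {q : Set (Fin d → F) × Finset ι | q.1 ∈ L (Set.range H) ∧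
      dim q.1 = i ∧ q.2 ∈ (nbc H q.1 (free H q.1)).filter p}.ncard ≤
    {q : Set (Fin d → F) × Finset ι | q.1 ∈ L (Set.range H') ∧
      dim q.1 = i ∧ q.2 ∈ (nbc H' q.1 (free H' q.1)).filter p}.ncard := by
  obtain ⟨φ, h1, h2, h3, h4, -⟩ := h.exists_injection
  have hfin : Set.Finite (L (Set.range H') ×ˢ (Set.univ : Set (Finset ι))) :=
    (Set.toFinite _).prod (Set.toFinite _)
  refine Set.ncard_le_ncard_of_injOn (fun q => (φ q.1, q.2)) ?_ ?_
    (hfin.subset fun q hq => ⟨hq.1, trivial⟩)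
  · rintro ⟨X, S⟩ ⟨hX, hd, hS⟩
    rw [Finset.mem_filter, mem_nbc] at hS
    refine ⟨h1 hX, (h3 X hX).trans hd, ?_⟩
    rw [Finset.mem_filter, mem_nbc]
    exact ⟨h4 X hX S hS.1, hS.2⟩
  · rintro ⟨X, S⟩ ⟨hX, -⟩ ⟨X', S'⟩ ⟨hX', -⟩ heq
    simp only [Prod.mk.injEq] at heq
    exact Prod.ext (h2 hX hX' heq.1) heq.2

theorem whitneyCoeff_le (h : Specializes H H' e) {𝒜 𝒜' : Set (Set (Fin d → F))} [Finite 𝒜]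
    [Finite 𝒜'] (h𝒜 : 𝒜 = Set.range H) (h𝒜' : 𝒜' = Set.range H') {i j : ℕ} (hj : j ≤ i)
    (hi : i ≤ d) : whitneyCoeff 𝒜 i j ≤ whitneyCoeff 𝒜' i j := by
  -- If the whole space is a member of `𝒜'` then it is one of `𝒜`, and both sides are zero. If it is
  -- a member of `𝒜` only, the left side is zero and the right side is a cardinality.
  by_cases hu' : Set.univ ∈ 𝒜'
  · have hu : Set.univ ∈ 𝒜 := h𝒜 ▸ h.univ_mem (h𝒜' ▸ hu')
    simp [whitneyCoeff, whitneyPoly, hu, hu']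
  · rw [whitneyCoeff_eq_ncard h𝒜' h.hyp' hu' hj hi]
    by_cases hu : Set.univ ∈ 𝒜
    · simp [whitneyCoeff, whitneyPoly, hu]
    · rw [whitneyCoeff_eq_ncard h𝒜 h.hyp hu hj hi]
      exact_mod_cast h.ncard_pairs_le i (fun S => S.card = j)

theorem whitneyFirst_le (h : Specializes H H' e) {𝒜 𝒜' : Set (Set (Fin d → F))} [Finite 𝒜]
    [Finite 𝒜'] (h𝒜 : 𝒜 = Set.range H) (h𝒜' : 𝒜' = Set.range H') {k : ℕ} (hk : k ≤ d) :
    whitneyFirst 𝒜 k ≤ whitneyFirst 𝒜' k := by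
  by_cases hu' : Set.univ ∈ 𝒜'
  · have hu : Set.univ ∈ 𝒜 := h𝒜 ▸ h.univ_mem (h𝒜' ▸ hu')
    simp [whitneyFirst, charPoly, hu, hu']
  · rw [whitneyFirst_eq_card h𝒜' h.hyp' hu' hk]
    by_cases hu : Set.univ ∈ 𝒜
    · simp [whitneyFirst, charPoly, hu]
    · rw [whitneyFirst_eq_card h𝒜 h.hyp hu hk]
      refine Int.ofNat_le.2 (Finset.card_le_card fun S hS => ?_)
      rw [Finset.mem_filter, mem_nbc] at hS ⊢
      exact ⟨h.isNBC_of_isOld ⟨Set.univ_nonempty, ∅, by simp, inter_empty.symm⟩ hS.1, hS.2⟩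

theorem whitneySecond_le (h : Specializes H H' e) (k : ℕ) :
    whitneySecond (Set.range H) k ≤ whitneySecond (Set.range H') k := by
  obtain ⟨φ, h1, h2, h3, -⟩ := h.exists_injection
  refine Set.ncard_le_ncard_of_injOn φ ?_ (h2.mono fun X hX => hX.1)
    ((Set.toFinite (L (Set.range H'))).subset fun X hX => hX.1)
  rintro X ⟨hX, hd⟩
  exact ⟨h1 hX, by rw [h3 X hX]; exact hd⟩

end Specializes

end WhitneyNumbers

end HypArr

/-! ### From the adjoint arrangement to specialization -/

namespace HypArr

/-- Otherwise `K ∩ X` would be a member of the restriction to `X` passing through `x`. -/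
theorem IsStratum.subset_of_mem {V : Type*} {𝒜 : Set (Set V)} {x : V} {X : Set V}
    (h : IsStratum 𝒜 x X) {K : Set V} (hK : K ∈ 𝒜) (hx : x ∈ K) : X ⊆ K := by
  by_contra hX
  exact h.2.2 ⟨K ∩ X, ⟨K, ⟨hK, fun h' => hX h'.2⟩, rfl, ⟨x, hx, h.2.1⟩⟩, hx, h.2.1⟩

theorem IsStratum.mem_of_mem {V : Type*} {𝒜 : Set (Set V)} {x x' : V} {X X' : Set V}
    (h : IsStratum 𝒜 x X) (h' : IsStratum 𝒜 x' X') (hX : X ⊆ X') {K : Set V} (hK : K ∈ 𝒜)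
    (hx : x' ∈ K) : x ∈ K :=
  h'.subset_of_mem hK hx (hX h.2.1)

section Adjoint

variable {F : Type*} [Field F] {d m : ℕ} {β : Fin m → Fin d → F} {b : Fin m → F}

theorem snoc_mem_hyperplane_snoc {d : ℕ} (v α : Fin d → F) (c a : F) :
    (Fin.snoc α a : Fin (d + 1) → F) ∈ hyperplane (Fin.snoc v c : Fin (d + 1) → F) 0 ↔
      α ⬝ᵥ v + c * a = 0 := by
  rw [mem_hyperplane, dotProduct_comm α v]
  simp [dotProduct, Fin.sum_univ_castSucc]

theorem exists_dotProduct_ne_zero (hspan : Submodule.span F (Set.range β) = ⊤)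
    {w : Fin d → F} (hw : w ≠ 0) : ∃ i, β i ⬝ᵥ w ≠ 0 := by
  by_contra hcon
  push Not at hcon
  apply hw
  have h : ∀ x : Fin d → F, x ⬝ᵥ w = 0 := by
    intro x
    have hx : x ∈ Submodule.span F (Set.range β) := hspan ▸ Submodule.mem_top
    induction hx using Submodule.span_induction with
    | mem x hx =>
      obtain ⟨i, rfl⟩ := hx
      exact hcon i
    | zero => simp
    | add x y _ _ hx hy => rw [add_dotProduct, hx, hy, add_zero]
    | smul c x _ hx => rw [smul_dotProduct, hx, smul_zero]
  ext i
  simpa using h (Pi.single i 1)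

theorem inter_arrangement_add {S : Finset (Fin m)} {v u : Fin d → F}
    (hv : v ∈ inter (fun i => hyperplane (β i) (b i)) S)
    (hu : u ∈ inter (fun i => hyperplane (β i) 0) S) :
    v + u ∈ inter (fun i => hyperplane (β i) (b i)) S := by
  intro s hs
  have h1 := mem_hyperplane.1 (hv s hs)
  have h2 := mem_hyperplane.1 (hu s hs)
  rw [mem_hyperplane, dotProduct_add, h1, h2, add_zero]

theorem inter_arrangement_sub {S : Finset (Fin m)} {v w : Fin d → F}
    (hv : v ∈ inter (fun i => hyperplane (β i) (b i)) S)
    (hw : w ∈ inter (fun i => hyperplane (β i) (b i)) S) :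
    v - w ∈ inter (fun i => hyperplane (β i) 0) S := by
  intro s hs
  have h1 := mem_hyperplane.1 (hv s hs)
  have h2 := mem_hyperplane.1 (hw s hs)
  rw [mem_hyperplane, dotProduct_sub, h1, h2, sub_self]

theorem inter_central_smul {S : Finset (Fin m)} {u : Fin d → F} (c : F)
    (hu : u ∈ inter (fun i => hyperplane (β i) 0) S) :
    c • u ∈ inter (fun i => hyperplane (β i) 0) S := by
  intro s hs
  have h1 := mem_hyperplane.1 (hu s hs)
  rw [mem_hyperplane, dotProduct_smul, h1, smul_zero]

theorem isHypFamily_arrangement (β : Fin m → Fin d → F) (b : Fin m → F) :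
    IsHypFamily (fun i => hyperplane (β i) (b i)) :=
  fun i => ⟨β i, b i, rfl⟩

/-- Every flat of an essential arrangement contains a zero-dimensional one. -/
theorem exists_vertex (hspan : Submodule.span F (Set.range β) = ⊤) (S : Finset (Fin m))
    (hne : (inter (fun i => hyperplane (β i) (b i)) S).Nonempty) :
    ∃ v, v ∈ inter (fun i => hyperplane (β i) (b i)) S ∧ {v} ∈ L (arrangement β b) := by
  induction hn : dim (inter (fun i => hyperplane (β i) (b i)) S) using Nat.strong_induction_on
    generalizing S with
  | _ n ih =>
  obtain ⟨v, hv⟩ := hne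
  by_cases hsing : inter (fun i => hyperplane (β i) (b i)) S = {v}
  · exact ⟨v, hv, mem_L_range.2 ⟨Set.singleton_nonempty v, S, hsing.symm⟩⟩
  · obtain ⟨w, hw, hwv⟩ : ∃ w ∈ inter (fun i => hyperplane (β i) (b i)) S, w ≠ v := by
      by_contra hcon
      push Not at hcon
      exact hsing (Set.eq_singleton_iff_unique_mem.2 ⟨hv, hcon⟩)
    -- Essentiality provides a `β i` that varies along `w - v`; its hyperplane cuts the flat
    -- properly and lowers the dimension.
    obtain ⟨i, hi⟩ := exists_dotProduct_ne_zero hspan (sub_ne_zero.2 hwv)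
    have hu := inter_arrangement_sub hw hv
    have heq : inter (fun i => hyperplane (β i) (b i)) (insert i S) =
        inter (fun i => hyperplane (β i) (b i)) S ∩ hyperplane (β i) (b i) := by
      rw [inter_insert, Set.inter_comm]
    have hne' : (inter (fun i => hyperplane (β i) (b i)) S ∩ hyperplane (β i) (b i)).Nonempty := by
      refine ⟨v + ((b i - β i ⬝ᵥ v) / (β i ⬝ᵥ (w - v))) • (w - v),
        inter_arrangement_add hv (inter_central_smul _ hu), ?_⟩
      rw [mem_hyperplane, dotProduct_add, dotProduct_smul, smul_eq_mul, div_mul_cancel₀ _ hi]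
      ring
    have hnot : ¬ inter (fun i => hyperplane (β i) (b i)) S ⊆ hyperplane (β i) (b i) := by
      intro hsub
      apply hi
      rw [dotProduct_sub, mem_hyperplane.1 (hsub hw), mem_hyperplane.1 (hsub hv), sub_self]
    have hdim := (isAff_inter_family (isHypFamily_arrangement β b).isAff S).dim_inter_hyperplane
      hne' hnot
    rw [← heq] at hne' hdim
    obtain ⟨v', hv', hL⟩ := ih _ (by omega) (insert i S) hne' rfl
    exact ⟨v', inter_anti (Finset.subset_insert _ _) hv', hL⟩

/-- A flat of the linearization not contained in `α · x = 0` contains a line of the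
linearization not contained in it. -/
theorem exists_line (hspan : Submodule.span F (Set.range β) = ⊤) (α : Fin d → F)
    (S : Finset (Fin m)) (hα : ¬ inter (fun i => hyperplane (β i) 0) S ⊆ hyperplane α 0) :
    ∃ u, u ∈ inter (fun i => hyperplane (β i) 0) S ∧
      (Submodule.span F {u} : Set (Fin d → F)) ∈ L (arrangement β 0) ∧ α ⬝ᵥ u ≠ 0 := by
  induction hn : dim (inter (fun i => hyperplane (β i) 0) S) using Nat.strong_induction_on
    generalizing S with
  | _ n ih =>
  obtain ⟨u, hu, huα⟩ := Set.not_subset.1 hα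
  have huα' : α ⬝ᵥ u ≠ 0 := huα
  have hspan_sub : (Submodule.span F {u} : Set (Fin d → F)) ⊆
      inter (fun i => hyperplane (β i) 0) S := by
    intro w hw
    obtain ⟨c, rfl⟩ := Submodule.mem_span_singleton.1 hw
    exact inter_central_smul c hu
  by_cases hline : inter (fun i => hyperplane (β i) 0) S =
      (Submodule.span F {u} : Set (Fin d → F))
  · exact ⟨u, hu, mem_L_range.2 ⟨⟨0, zero_mem _⟩, S, hline.symm⟩, huα'⟩
  · obtain ⟨w, hw, hwu⟩ := Set.not_subset.1 fun h' => hline (subset_antisymm h' hspan_sub)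
    -- The projection of `w` along `u` to the kernel of `α`; it is nonzero because `w` is not on the
    -- line of `u`.
    set z := w - ((α ⬝ᵥ w) / (α ⬝ᵥ u)) • u with hz
    have hzα : α ⬝ᵥ z = 0 := by
      rw [hz, dotProduct_sub, dotProduct_smul, smul_eq_mul, div_mul_cancel₀ _ huα', sub_self]
    have hzne : z ≠ 0 := fun h0 => hwu (by
      rw [sub_eq_zero.1 (hz.symm.trans h0)]
      exact Submodule.smul_mem _ _ (Submodule.mem_span_singleton_self u))
    have hzS : z ∈ inter (fun i => hyperplane (β i) 0) S :=
      inter_arrangement_sub (b := 0) hw (inter_central_smul _ hu)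
    obtain ⟨i, hi⟩ := exists_dotProduct_ne_zero hspan hzne
    have heq : inter (fun i => hyperplane (β i) 0) (insert i S) =
        inter (fun i => hyperplane (β i) 0) S ∩ hyperplane (β i) 0 := by
      rw [inter_insert, Set.inter_comm]
    have haff := isAff_inter_family (isHypFamily_arrangement β 0).isAff S
    have hne' : (inter (fun i => hyperplane (β i) 0) S ∩ hyperplane (β i) 0).Nonempty :=
      ⟨0, fun s _ => by simp [mem_hyperplane], by simp [mem_hyperplane]⟩
    have hnot : ¬ inter (fun i => hyperplane (β i) 0) S ⊆ hyperplane (β i) 0 :=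
      fun hsub => hi (hsub hzS)
    have hdim := haff.dim_inter_hyperplane hne' hnot
    -- If the smaller flat lay in the kernel of `α`, the sections by `α` and by `β i` would
    -- coincide, and `z` would be orthogonal to `β i`.
    have hα' : ¬ inter (fun i => hyperplane (β i) 0) (insert i S) ⊆ hyperplane α 0 := by
      rw [heq]
      intro hsub
      have := inter_eq_of_subset haff ⟨_, _, rfl⟩ ⟨_, _, rfl⟩ hne' hnot hα hsub
      exact hi (this.ge ⟨hzS, hzα⟩).2
    simp only [Pi.zero_apply] at hdim
    rw [← heq] at hdim
    obtain ⟨v', hv', hL⟩ := ih _ (by omega) (insert i S) hα' rfl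
    exact ⟨v', inter_anti (Finset.subset_insert _ _) hv', hL⟩

/-- The family obtained by appending one hyperplane to an arrangement. -/
def extFamily (β : Fin m → Fin d → F) (b : Fin m → F) (α : Fin d → F) (a : F) :
    Fin (m + 1) → Set (Fin d → F) :=
  Fin.snoc (α := fun _ => Set (Fin d → F)) (fun i => hyperplane (β i) (b i)) (hyperplane α a)

theorem extension_eq_range (β : Fin m → Fin d → F) (b : Fin m → F) (α : Fin d → F) (a : F) :
    extension (arrangement β b) α a = Set.range (extFamily β b α a) := by
  ext K
  simp only [extension, arrangement, extFamily, Set.mem_insert_iff, Set.mem_range]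
  constructor
  · rintro (rfl | ⟨i, rfl⟩)
    · exact ⟨Fin.last m, by simp⟩
    · exact ⟨i.castSucc, by simp⟩
  · rintro ⟨i, rfl⟩
    induction i using Fin.lastCases with
    | last => left; simp
    | cast i => right; exact ⟨i, by simp⟩

theorem isHypFamily_extFamily (β : Fin m → Fin d → F) (b : Fin m → F) (α : Fin d → F) (a : F) :
    IsHypFamily (extFamily β b α a) := by
  intro i
  induction i using Fin.lastCases with
  | last => exact ⟨α, a, by simp [extFamily]⟩
  | cast i => exact ⟨β i, b i, by simp [extFamily]⟩

theorem exists_inter_extFamily {S : Finset (Fin (m + 1))} (hS : Fin.last m ∉ S)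
    (β : Fin m → Fin d → F) (b : Fin m → F) (α : Fin d → F) (a : F) :
    ∃ T, inter (extFamily β b α a) S = inter (fun i => hyperplane (β i) (b i)) T := by
  refine ⟨Finset.univ.filter fun i => i.castSucc ∈ S, ?_⟩
  ext v
  simp only [inter, Set.mem_ofPred_eq, Finset.mem_filter, Finset.mem_univ, true_and]
  constructor
  · intro h i hi
    simpa [extFamily] using h _ hi
  · intro h s hs
    induction s using Fin.lastCases with
    | last => exact absurd hs hS
    | cast i => simpa [extFamily] using h i hs

theorem specializes_of_isStratum (hspan : Submodule.span F (Set.range β) = ⊤)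
    {α α' : Fin d → F} {a a' : F} {X X' : Set (Fin (d + 1) → F)}
    (hX : IsStratum (inducedAdjoint β b) (Fin.snoc α a : Fin (d + 1) → F) X)
    (hX' : IsStratum (inducedAdjoint β b) (Fin.snoc α' a' : Fin (d + 1) → F) X')
    (hsub : X ⊆ X') :
    Specializes (extFamily β b α a) (extFamily β b α' a') (Fin.last m) := by
  have hvertex : ∀ v, {v} ∈ L (arrangement β b) → α' ⬝ᵥ v = a' → α ⬝ᵥ v = a := by
    intro v hv h
    have := hX.mem_of_mem hX' hsub (.inl ⟨v, hv, rfl⟩)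
      ((snoc_mem_hyperplane_snoc v α' (-1) a').2 (by rw [h]; ring))
    have := (snoc_mem_hyperplane_snoc v α (-1) a).1 this
    linear_combination this
  have hlines : ∀ u, u ≠ 0 → (Submodule.span F {u} : Set (Fin d → F)) ∈ L (arrangement β 0) →
      α' ⬝ᵥ u = 0 → α ⬝ᵥ u = 0 := by
    intro u hu0 hu h
    have := hX.mem_of_mem hX' hsub (.inr ⟨u, hu0, hu, rfl⟩)
      ((snoc_mem_hyperplane_snoc u α' 0 a').2 (by rw [h]; ring))
    have := (snoc_mem_hyperplane_snoc u α 0 a).1 this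
    linear_combination this
  -- If `α` varies on a flat, so does `α'`: `exists_line` gives a line of the linearization,
  -- parallel to the flat, on which `α` is nonzero, and by `hlines` so is `α'`.
  have hdir : ∀ (T : Finset (Fin m)) (y y' : Fin d → F),
      y ∈ inter (fun i => hyperplane (β i) (b i)) T →
      y' ∈ inter (fun i => hyperplane (β i) (b i)) T → α ⬝ᵥ y ≠ α ⬝ᵥ y' →
      ∃ u ∈ inter (fun i => hyperplane (β i) 0) T, α' ⬝ᵥ u ≠ 0 := by
    intro T y y' hy hy' hne
    obtain ⟨u, hu, huL, huα⟩ := exists_line hspan α T fun hs => by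
      have := mem_hyperplane.1 (hs (inter_arrangement_sub hy hy'))
      rw [dotProduct_sub, sub_eq_zero] at this
      exact hne this
    exact ⟨u, hu, fun h => huα (hlines u (fun h0 => huα (by simp [h0])) huL h)⟩
  refine ⟨Fin.le_last, isHypFamily_extFamily β b α a, isHypFamily_extFamily β b α' a', ?_, ?_, ?_⟩
  · intro i hi
    induction i using Fin.lastCases with
    | last => exact absurd rfl hi
    | cast i => simp [extFamily]
  · intro S hS hne hS'
    obtain ⟨T, hT⟩ := exists_inter_extFamily hS β b α a
    rw [hT] at hne hS' ⊢
    simp only [extFamily, Fin.snoc_last] at hS' ⊢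
    -- The vertex `v` lies on both added members. A point of the flat off the first would make `α`,
    -- hence `α'`, vary on a flat where `α'` is constant.
    obtain ⟨v, hv, hvL⟩ := exists_vertex hspan T hne
    have hva := hvertex v hvL (hS' hv)
    intro y hy
    by_contra hya
    obtain ⟨u, hu, huα⟩ := hdir T y v hy hv (by rw [hva]; exact hya)
    apply huα
    have h1 := mem_hyperplane.1 (hS' (inter_arrangement_add hv hu))
    rw [dotProduct_add, mem_hyperplane.1 (hS' hv)] at h1
    linear_combination h1
  · intro S hS hne hnot
    obtain ⟨T, hT⟩ := exists_inter_extFamily hS β b α a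
    rw [hT] at hne hnot ⊢
    simp only [extFamily, Fin.snoc_last] at hne hnot ⊢
    obtain ⟨y, hy, hya⟩ := hne
    obtain ⟨y', hy', hya'⟩ := Set.not_subset.1 hnot
    obtain ⟨u, hu, huα⟩ := hdir T y' y hy' hy (by rw [mem_hyperplane.1 hya]; exact hya')
    -- The point reached from `y` along `u` where `α'` takes the value `a'`.
    refine ⟨y + ((a' - α' ⬝ᵥ y) / (α' ⬝ᵥ u)) • u,
      inter_arrangement_add hy (inter_central_smul _ hu), ?_⟩
    rw [mem_hyperplane, dotProduct_add, dotProduct_smul, smul_eq_mul, div_mul_cancel₀ _ huα]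
    ring

end Adjoint

end HypArr

namespace HypArr

/-! ### Sign vectors of real arrangements -/

section Cells

variable {d : ℕ} {ι : Type*} (γ : ι → Fin d → ℝ) (c : ι → ℝ)

/-- The points of `X` lying on the positive side of the hyperplanes with index in `P` and on the
negative side of the other hyperplanes with index in `I`. -/
def cell (X : Set (Fin d → ℝ)) (I P : Finset ι) : Set (Fin d → ℝ) :=
  {x | x ∈ X ∧ ∀ i ∈ I, (i ∈ P → c i < γ i ⬝ᵥ x) ∧ (i ∉ P → γ i ⬝ᵥ x < c i)}

open Classical in
/-- The sign vectors, given by their positive parts, that are realized by points of `X`. -/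
noncomputable def signs (X : Set (Fin d → ℝ)) (I : Finset ι) : Finset (Finset ι) :=
  I.powerset.filter fun P => (cell γ c X I P).Nonempty

variable {γ c}

theorem mem_signs {X : Set (Fin d → ℝ)} {I P : Finset ι} :
    P ∈ signs γ c X I ↔ P ⊆ I ∧ (cell γ c X I P).Nonempty := by
  simp [signs]

theorem IsAff.convex {X : Set (Fin d → ℝ)} (hX : IsAff X) : Convex ℝ X := by
  obtain ⟨s, rfl⟩ := hX
  exact s.convex

theorem convex_cell {X : Set (Fin d → ℝ)} (hX : Convex ℝ X) (I P : Finset ι) :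
    Convex ℝ (cell γ c X I P) := by
  have hlin : ∀ i, IsLinearMap ℝ fun x : Fin d → ℝ => γ i ⬝ᵥ x := fun i =>
    (dotLin (γ i)).isLinear
  intro x hx y hy a b ha hb hab
  refine ⟨hX hx.1 hy.1 ha hb hab, fun i hi => ⟨fun hP => ?_, fun hP => ?_⟩⟩
  · exact convex_halfSpace_gt (hlin i) (c i) ((hx.2 i hi).1 hP) ((hy.2 i hi).1 hP) ha hb hab
  · exact convex_halfSpace_lt (hlin i) (c i) ((hx.2 i hi).2 hP) ((hy.2 i hi).2 hP) ha hb hab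

theorem cell_congr {X : Set (Fin d → ℝ)} {I P Q : Finset ι} (h : ∀ i ∈ I, i ∈ P ↔ i ∈ Q) :
    cell γ c X I P = cell γ c X I Q := by
  ext x
  refine and_congr_right fun _ => forall₂_congr fun i hi => ?_
  rw [h i hi]

theorem exists_mem_cell {X : Set (Fin d → ℝ)} {I : Finset ι} {x : Fin d → ℝ} (hx : x ∈ X)
    (hI : ∀ i ∈ I, γ i ⬝ᵥ x ≠ c i) : ∃ P ∈ signs γ c X I, x ∈ cell γ c X I P := by
  classical
  have hmem : x ∈ cell γ c X I (I.filter fun i => c i < γ i ⬝ᵥ x) := by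
    refine ⟨hx, fun i hi => ⟨fun h => (Finset.mem_filter.1 h).2, fun h => ?_⟩⟩
    refine lt_of_le_of_ne (not_lt.1 fun h' => h (Finset.mem_filter.2 ⟨hi, h'⟩)) (hI i hi)
  exact ⟨_, mem_signs.2 ⟨Finset.filter_subset _ _, x, hmem⟩, hmem⟩

theorem ne_of_mem_cell {X : Set (Fin d → ℝ)} {I P : Finset ι} {x : Fin d → ℝ}
    (hx : x ∈ cell γ c X I P) {i : ι} (hi : i ∈ I) : γ i ⬝ᵥ x ≠ c i := by
  by_cases hP : i ∈ P
  · exact ((hx.2 i hi).1 hP).ne'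
  · exact ((hx.2 i hi).2 hP).ne

theorem eq_of_mem_cell {X X' : Set (Fin d → ℝ)} {I P Q : Finset ι} {x : Fin d → ℝ}
    (hP : P ⊆ I) (hQ : Q ⊆ I) (hx : x ∈ cell γ c X I P) (hx' : x ∈ cell γ c X' I Q) : P = Q := by
  have key : ∀ {Y Y' : Set (Fin d → ℝ)} {P Q : Finset ι}, P ⊆ I → x ∈ cell γ c Y I P →
      x ∈ cell γ c Y' I Q → P ⊆ Q := by
    intro Y Y' P Q hP hx hx' i hi
    by_contra hQ
    exact lt_asymm ((hx.2 i (hP hi)).1 hi) ((hx'.2 i (hP hi)).2 hQ)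
  exact subset_antisymm (key hP hx hx') (key hQ hx' hx)

theorem mem_cell_insert [DecidableEq ι] {X : Set (Fin d → ℝ)} {I P : Finset ι} {e : ι}
    {x : Fin d → ℝ} : x ∈ cell γ c X (insert e I) P ↔
      x ∈ cell γ c X I P ∧ (e ∈ P → c e < γ e ⬝ᵥ x) ∧ (e ∉ P → γ e ⬝ᵥ x < c e) := by
  simp only [cell, Set.mem_ofPred_eq, Finset.forall_mem_insert]
  tauto

/-- A point of a cell on a hyperplane can be moved within the cell to either side of it. -/
theorem exists_mem_cell_of_eq {X : Set (Fin d → ℝ)} (hX : IsAff X) {I P : Finset ι} {e : ι}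
    (hXe : ¬ X ⊆ hyperplane (γ e) (c e)) {x : Fin d → ℝ} (hx : x ∈ cell γ c X I P)
    (hxe : γ e ⬝ᵥ x = c e) :
    (∃ y ∈ cell γ c X I P, c e < γ e ⬝ᵥ y) ∧ ∃ y ∈ cell γ c X I P, γ e ⬝ᵥ y < c e := by
  obtain ⟨y, hy, hye⟩ := Set.not_subset.1 hXe
  rw [mem_hyperplane] at hye
  have hval : ∀ i (t : ℝ), γ i ⬝ᵥ (x + t • (y - x)) = γ i ⬝ᵥ x + t * (γ i ⬝ᵥ y - γ i ⬝ᵥ x) := by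
    intro i t
    rw [dotProduct_add, dotProduct_smul, dotProduct_sub, smul_eq_mul]
  have hmem : ∀ t : ℝ, x + t • (y - x) ∈ X := by
    intro t
    obtain ⟨s, rfl⟩ := hX
    have := AffineMap.lineMap_mem t hx.1 hy
    rwa [AffineMap.lineMap_apply, vsub_eq_sub, vadd_eq_add, add_comm] at this
  -- The finitely many strict inequalities are open in `t`, so small steps of either sign stay in
  -- the cell; they land on opposite sides of the hyperplane.
  have hev : ∀ᶠ t in nhds (0 : ℝ), x + t • (y - x) ∈ cell γ c X I P := by
    have : ∀ᶠ t in nhds (0 : ℝ), ∀ i ∈ I,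
        (i ∈ P → c i < γ i ⬝ᵥ x + t * (γ i ⬝ᵥ y - γ i ⬝ᵥ x)) ∧
        (i ∉ P → γ i ⬝ᵥ x + t * (γ i ⬝ᵥ y - γ i ⬝ᵥ x) < c i) := by
      refine (Filter.eventually_all_finset I).2 fun i hi => ?_
      have hcont : Filter.Tendsto (fun t : ℝ => γ i ⬝ᵥ x + t * (γ i ⬝ᵥ y - γ i ⬝ᵥ x))
          (nhds 0) (nhds (γ i ⬝ᵥ x)) := by
        have : Continuous fun t : ℝ => γ i ⬝ᵥ x + t * (γ i ⬝ᵥ y - γ i ⬝ᵥ x) := by fun_prop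
        simpa using this.tendsto 0
      by_cases hP : i ∈ P
      · filter_upwards [hcont.eventually_const_lt ((hx.2 i hi).1 hP)] with t ht
        exact ⟨fun _ => ht, fun h => absurd hP h⟩
      · filter_upwards [hcont.eventually_lt_const ((hx.2 i hi).2 hP)] with t ht
        exact ⟨fun h => absurd h hP, fun _ => ht⟩
    filter_upwards [this] with t ht
    refine ⟨hmem t, fun i hi => ?_⟩
    rw [hval]
    exact ht i hi
  obtain ⟨ε, hε, hball⟩ := Metric.eventually_nhds_iff.1 hev
  have h1 := @hball (ε / 2) (by rw [Real.dist_eq, sub_zero, abs_of_pos (by linarith)]; linarith)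
  have h2 := @hball (-(ε / 2)) (by
    rw [Real.dist_eq, sub_zero, abs_neg, abs_of_pos (by linarith)]; linarith)
  have hε2 : 0 < ε / 2 := by linarith
  rcases lt_or_gt_of_ne hye with h | h
  · have hm := mul_pos hε2 (sub_pos.2 h)
    refine ⟨⟨_, h2, ?_⟩, ⟨_, h1, ?_⟩⟩ <;> rw [hval, hxe] <;> linarith
  · have hm := mul_pos hε2 (sub_pos.2 h)
    refine ⟨⟨_, h1, ?_⟩, ⟨_, h2, ?_⟩⟩ <;> rw [hval, hxe] <;> linarith

theorem exists_mem_cell_eq {X : Set (Fin d → ℝ)} (hX : IsAff X) {I P : Finset ι} {e : ι}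
    {x y : Fin d → ℝ} (hx : x ∈ cell γ c X I P) (hxe : c e < γ e ⬝ᵥ x)
    (hy : y ∈ cell γ c X I P) (hye : γ e ⬝ᵥ y < c e) :
    ∃ z ∈ cell γ c X I P, γ e ⬝ᵥ z = c e := by
  have hcont : ContinuousOn (fun z => γ e ⬝ᵥ z) (cell γ c X I P) := by
    have : Continuous fun z => γ e ⬝ᵥ z := (dotLin (γ e)).continuous_of_finiteDimensional
    exact this.continuousOn
  exact (convex_cell hX.convex I P).isPreconnected.intermediate_value hy hx hcont
    ⟨hye.le, hxe.le⟩

/-- Every sign vector realized on `I` is realized on at least one side of the new hyperplane, and on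
both sides exactly when its cell meets that hyperplane. Inclusion and exclusion for `Q₁` and `Q₂`
gives the count. -/
theorem card_signs_insert [DecidableEq ι] {X : Set (Fin d → ℝ)} (hX : IsAff X) {I : Finset ι}
    {e : ι} (he : e ∉ I) (hXe : ¬ X ⊆ hyperplane (γ e) (c e)) :
    (signs γ c X (insert e I)).card =
      (signs γ c X I).card + (signs γ c (X ∩ hyperplane (γ e) (c e)) I).card := by
  classical
  set Q₁ := I.powerset.filter fun P => ∃ y ∈ cell γ c X I P, c e < γ e ⬝ᵥ y with hQ₁
  set Q₂ := I.powerset.filter fun P => ∃ y ∈ cell γ c X I P, γ e ⬝ᵥ y < c e with hQ₂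
  have hsub : ∀ P ⊆ I, e ∉ P := fun P hP h => he (hP h)
  have hins : ∀ P : Finset ι, cell γ c X I (insert e P) = cell γ c X I P := fun P =>
    cell_congr fun i hi => by
      rw [Finset.mem_insert, or_iff_right]
      exact fun h => he (h ▸ hi)
  have hunion : Q₁ ∪ Q₂ = signs γ c X I := by
    ext P
    rw [Finset.mem_union, hQ₁, hQ₂, Finset.mem_filter, Finset.mem_filter, mem_signs,
      Finset.mem_powerset, ← and_or_left]
    refine and_congr_right fun _ => ⟨?_, ?_⟩
    · rintro (⟨y, hy, -⟩ | ⟨y, hy, -⟩) <;> exact ⟨y, hy⟩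
    · rintro ⟨x, hx⟩
      rcases lt_trichotomy (γ e ⬝ᵥ x) (c e) with h | h | h
      · exact .inr ⟨x, hx, h⟩
      · exact .inl (exists_mem_cell_of_eq hX hXe hx h).1
      · exact .inl ⟨x, hx, h⟩
  have hinter : Q₁ ∩ Q₂ = signs γ c (X ∩ hyperplane (γ e) (c e)) I := by
    ext P
    rw [Finset.mem_inter, hQ₁, hQ₂, Finset.mem_filter, Finset.mem_filter, mem_signs,
      Finset.mem_powerset, ← and_and_left]
    refine and_congr_right fun _ => ⟨?_, ?_⟩
    · rintro ⟨⟨x, hx, hxe⟩, y, hy, hye⟩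
      obtain ⟨z, hz, hze⟩ := exists_mem_cell_eq hX hx hxe hy hye
      exact ⟨z, ⟨hz.1, hze⟩, hz.2⟩
    · rintro ⟨x, ⟨hx, hxe⟩, hx'⟩
      exact exists_mem_cell_of_eq hX hXe ⟨hx, hx'⟩ hxe
  have hdecomp : signs γ c X (insert e I) = Q₁.image (insert e) ∪ Q₂ := by
    ext P
    rw [Finset.mem_union, Finset.mem_image, mem_signs]
    by_cases hP : e ∈ P
    · obtain ⟨P', hP', rfl⟩ : ∃ P', e ∉ P' ∧ P = insert e P' :=
        ⟨P.erase e, Finset.notMem_erase _ _, (Finset.insert_erase hP).symm⟩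
      constructor
      · rintro ⟨h1, x, hx⟩
        rw [mem_cell_insert, hins] at hx
        refine .inl ⟨P', Finset.mem_filter.2 ⟨Finset.mem_powerset.2 ?_, x, hx.1,
          hx.2.1 (Finset.mem_insert_self _ _)⟩, rfl⟩
        exact (Finset.insert_subset_insert_iff hP').1 h1
      · rintro (⟨P'', hP'', heq⟩ | h)
        · rw [← heq]
          obtain ⟨h1, x, hx, hxe⟩ := Finset.mem_filter.1 hP''
          refine ⟨Finset.insert_subset_insert _ (Finset.mem_powerset.1 h1), x, ?_⟩
          rw [mem_cell_insert, hins]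
          exact ⟨hx, fun _ => hxe, fun h => absurd (Finset.mem_insert_self _ _) h⟩
        · exact absurd hP (hsub _ (Finset.mem_powerset.1 (Finset.mem_filter.1 h).1))
    · constructor
      · rintro ⟨h1, x, hx⟩
        rw [mem_cell_insert] at hx
        exact .inr (Finset.mem_filter.2 ⟨Finset.mem_powerset.2
          ((Finset.subset_insert_iff_of_notMem hP).1 h1), x, hx.1, hx.2.2 hP⟩)
      · rintro (⟨P'', -, rfl⟩ | h)
        · exact absurd (Finset.mem_insert_self _ _) hP
        · obtain ⟨h1, x, hx, hxe⟩ := Finset.mem_filter.1 h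
          refine ⟨(Finset.mem_powerset.1 h1).trans (Finset.subset_insert _ _), x, ?_⟩
          rw [mem_cell_insert]
          exact ⟨hx, fun h => absurd h hP, fun _ => hxe⟩
  have hmem₁ : ∀ P ∈ Q₁, e ∉ P := fun P hP =>
    hsub P (Finset.mem_powerset.1 (Finset.mem_filter.1 hP).1)
  rw [hdecomp, Finset.card_union_of_disjoint, Finset.card_image_of_injOn, ← hunion, ← hinter,
    Finset.card_union_add_card_inter]
  · intro S hS T hT h
    rw [← Finset.erase_insert (hmem₁ S hS), h, Finset.erase_insert (hmem₁ T hT)]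
  · rw [Finset.disjoint_left]
    intro S hS hS'
    obtain ⟨T, -, rfl⟩ := Finset.mem_image.1 hS
    exact hsub _ (Finset.mem_powerset.1 (Finset.mem_filter.1 hS').1) (Finset.mem_insert_self _ _)

/-- The number of realized sign vectors is the number of no-broken-circuit sets. -/
theorem card_signs_eq_card_nbc [LinearOrder ι] {X : Set (Fin d → ℝ)} (hX : IsAff X)
    (I : Finset ι) :
    (signs γ c X I).card = (nbc (fun i => hyperplane (γ i) (c i)) X I).card := by
  induction I using Finset.induction_on_max generalizing X with
  | empty =>
    congr 1
    ext P
    rw [mem_signs, mem_nbc]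
    refine and_congr_right fun hP => ?_
    rw [Finset.subset_empty.1 hP]
    simp [cell, inter_empty, Set.Nonempty]
  | insert e I he ih =>
    by_cases hXe : X ⊆ hyperplane (γ e) (c e)
    · rw [nbc_eq_empty (Finset.mem_insert_self e I) hXe, Finset.card_empty, Finset.card_eq_zero]
      refine Finset.eq_empty_of_forall_notMem fun P hP => ?_
      obtain ⟨-, x, hx⟩ := mem_signs.1 hP
      exact ne_of_mem_cell hx (Finset.mem_insert_self e I) (hXe hx.1)
    · rw [card_signs_insert hX (fun h => lt_irrefl _ (he e h)) hXe, card_nbc_insert_max he hXe,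
        ih hX, ih (hX.inter (isAff_hyperplane _ _))]

end Cells

/-! ### Faces and regions -/

section Faces

variable {d : ℕ} {ι : Type*} {γ : ι → Fin d → ℝ} {c : ι → ℝ}

theorem mem_complement_restriction [Fintype ι] {V : Type*} {H : ι → Set V} {X : Set V} {x : V} :
    x ∈ complement X (restriction (Set.range H) X) ↔ x ∈ X ∧ ∀ i ∈ free H X, x ∉ H i := by
  constructor
  · rintro ⟨h1, h2⟩
    refine ⟨h1, fun i hi hx => h2 ⟨H i ∩ X, ⟨H i, ⟨⟨i, rfl⟩, ?_⟩, rfl, x, hx, h1⟩, hx, h1⟩⟩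
    exact fun h => mem_free.1 hi h.2
  · rintro ⟨h1, h2⟩
    refine ⟨h1, ?_⟩
    rintro ⟨K, ⟨K', ⟨⟨i, rfl⟩, hi⟩, rfl, -⟩, hx⟩
    exact h2 i (mem_free.2 fun h => hi ⟨⟨i, rfl⟩, h⟩) hx.1

/-- A cell is convex, hence connected. Conversely, by the intermediate value theorem no sign can
change on a connected component of the complement. -/
theorem connectedComponentIn_eq_cell [Fintype ι] {X : Set (Fin d → ℝ)} (hX : IsAff X)
    {P : Finset ι} {x : Fin d → ℝ}
    (hx : x ∈ cell γ c X (free (fun i => hyperplane (γ i) (c i)) X) P) :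
    connectedComponentIn (complement X
        (restriction (Set.range fun i => hyperplane (γ i) (c i)) X)) x =
      cell γ c X (free (fun i => hyperplane (γ i) (c i)) X) P := by
  have hsub : cell γ c X (free (fun i => hyperplane (γ i) (c i)) X) P ⊆
      complement X (restriction (Set.range fun i => hyperplane (γ i) (c i)) X) := fun y hy =>
    mem_complement_restriction.2 ⟨hy.1, fun i hi => ne_of_mem_cell hy hi⟩
  refine subset_antisymm ?_
    ((convex_cell hX.convex _ P).isPreconnected.subset_connectedComponentIn hx hsub)
  intro y hy
  have hM := connectedComponentIn_subset
    (complement X (restriction (Set.range fun i => hyperplane (γ i) (c i)) X)) x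
  have hxC := mem_connectedComponentIn (hsub hx)
  have hne : ∀ i ∈ free (fun i => hyperplane (γ i) (c i)) X, ∀ z ∈ connectedComponentIn
      (complement X (restriction (Set.range fun i => hyperplane (γ i) (c i)) X)) x,
      γ i ⬝ᵥ z ≠ c i := fun i hi z hz => (mem_complement_restriction.1 (hM hz)).2 i hi
  have hcont : ∀ i, ContinuousOn (fun z => γ i ⬝ᵥ z) (connectedComponentIn
      (complement X (restriction (Set.range fun i => hyperplane (γ i) (c i)) X)) x) := fun i => by
    have : Continuous fun z => γ i ⬝ᵥ z := (dotLin (γ i)).continuous_of_finiteDimensional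
    exact this.continuousOn
  refine ⟨(hM hy).1, fun i hi => ⟨fun hP => ?_, fun hP => ?_⟩⟩
  · by_contra hlt
    obtain ⟨z, hz, hzc⟩ := isPreconnected_connectedComponentIn.intermediate_value hy hxC (hcont i)
      ⟨not_lt.1 hlt, ((hx.2 i hi).1 hP).le⟩
    exact hne i hi z hz hzc
  · by_contra hlt
    obtain ⟨z, hz, hzc⟩ := isPreconnected_connectedComponentIn.intermediate_value hxC hy (hcont i)
      ⟨((hx.2 i hi).2 hP).le, not_lt.1 hlt⟩
    exact hne i hi z hz hzc

theorem regions_restriction_eq_image [Fintype ι] {X : Set (Fin d → ℝ)} (hX : IsAff X) :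
    regions X (restriction (Set.range fun i => hyperplane (γ i) (c i)) X) =
      cell γ c X (free (fun i => hyperplane (γ i) (c i)) X) ''
        signs γ c X (free (fun i => hyperplane (γ i) (c i)) X) := by
  ext C
  constructor
  · rintro ⟨x, hx, rfl⟩
    obtain ⟨h1, h2⟩ := mem_complement_restriction.1 hx
    obtain ⟨P, hP, hxP⟩ := exists_mem_cell h1 h2
    exact ⟨P, hP, (connectedComponentIn_eq_cell hX hxP).symm⟩
  · rintro ⟨P, hP, rfl⟩
    obtain ⟨-, x, hx⟩ := mem_signs.1 hP
    exact ⟨x, mem_complement_restriction.2 ⟨hx.1, fun i hi => ne_of_mem_cell hx hi⟩,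
      (connectedComponentIn_eq_cell hX hx).symm⟩

theorem flat_subset_of_generic [Fintype ι] {V : Type*} {H : ι → Set V} {X Y : Set V} {x : V}
    (hY : Y ∈ L (Set.range H)) (hxX : ∀ i ∈ free H X, x ∉ H i) (hxY : x ∈ Y) : X ⊆ Y := by
  by_contra h
  obtain ⟨i, hi, hYi⟩ := exists_not_subset_of_ssubset hY h
  exact hxX i (mem_free.2 hi) (hYi hxY)

/-- Faces correspond to pairs of a flat and a realized sign vector, both determined by any point of
the face: the flat by `flat_subset_of_generic`, the signs by `eq_of_mem_cell`. Sign vectors are then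
traded for NBC sets flat by flat. -/
theorem faceNumber_eq_ncard [Fintype ι] [LinearOrder ι] (k : ℕ) :
    faceNumber (Set.range fun i => hyperplane (γ i) (c i)) k =
      {q : Set (Fin d → ℝ) × Finset ι |
        q.1 ∈ L (Set.range fun i => hyperplane (γ i) (c i)) ∧ dim q.1 = k ∧
        q.2 ∈ (nbc (fun i => hyperplane (γ i) (c i)) q.1
          (free (fun i => hyperplane (γ i) (c i)) q.1)).filter fun _ => True}.ncard := by
  classical
  set H : ι → Set (Fin d → ℝ) := fun i => hyperplane (γ i) (c i) with hHdef
  let _ : Fintype (L (Set.range H)) := Fintype.ofFinite _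
  have hH : IsHypFamily H := fun i => ⟨γ i, c i, rfl⟩
  rw [ncard_flat_pairs H (fun X => dim X = k)
    (fun X => (nbc H X (free H X)).filter fun _ => True)]
  have hcard : ∀ X : L (Set.range H), ((nbc H X.1 (free H X.1)).filter fun _ => True).card =
      (signs γ c X.1 (free H X.1)).card := fun X => by
    rw [Finset.filter_true, card_signs_eq_card_nbc (isAff_of_mem_L hH X.2)]
  rw [Finset.sum_congr rfl fun X _ => hcard X, ← ncard_flat_pairs H (fun X => dim X = k)
    (fun X => signs γ c X (free H X))]
  have hfin : Set.Finite (L (Set.range H) ×ˢ (Set.univ : Set (Finset ι))) :=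
    (Set.toFinite _).prod (Set.toFinite _)
  rw [Set.Finite.cast_ncard_eq (hfin.subset fun q hq => ⟨hq.1, trivial⟩)]
  have hfaces : faces (Set.range H) k = (fun q : Set (Fin d → ℝ) × Finset ι =>
      cell γ c q.1 (free H q.1) q.2) '' {q : Set (Fin d → ℝ) × Finset ι |
        q.1 ∈ L (Set.range H) ∧ dim q.1 = k ∧ q.2 ∈ signs γ c q.1 (free H q.1)} := by
    ext C
    constructor
    · rintro ⟨X, hX, hd, hC⟩
      rw [regions_restriction_eq_image (isAff_of_mem_L hH hX)] at hC
      obtain ⟨P, hP, rfl⟩ := hC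
      exact ⟨(X, P), ⟨hX, hd, hP⟩, rfl⟩
    · rintro ⟨⟨X, P⟩, ⟨hX, hd, hP⟩, rfl⟩
      refine ⟨X, hX, hd, ?_⟩
      rw [regions_restriction_eq_image (isAff_of_mem_L hH hX)]
      exact ⟨P, hP, rfl⟩
  rw [faceNumber, hfaces, Set.InjOn.encard_image]
  rintro ⟨X, P⟩ ⟨hX, -, hP⟩ ⟨X', P'⟩ ⟨hX', -, hP'⟩ heq
  simp only at hX hP hX' hP' heq
  obtain ⟨hPI, x, hx⟩ := mem_signs.1 hP
  have hx' : x ∈ cell γ c X' (free H X') P' := heq ▸ hx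
  have hXX : X = X' := subset_antisymm
    (flat_subset_of_generic hX' (fun i hi => ne_of_mem_cell hx hi) hx'.1)
    (flat_subset_of_generic hX (fun i hi => ne_of_mem_cell hx' hi) hx.1)
  subst hXX
  rw [eq_of_mem_cell hPI (mem_signs.1 hP').1 hx hx']

theorem regionNumber_eq_zero {𝒜 : Set (Set (Fin d → ℝ))} (hu : Set.univ ∈ 𝒜) :
    regionNumber 𝒜 = 0 := by
  rw [regionNumber, Set.encard_eq_zero]
  refine Set.eq_empty_of_forall_notMem ?_
  rintro C ⟨x, hx, -⟩
  exact hx.2 ⟨_, hu, trivial⟩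

/-- The whole space is the only flat of dimension `d`, and restricting to it changes the complement
only if it is itself a member. -/
theorem regionNumber_eq_faceNumber [Finite ι] {H : ι → Set (Fin d → ℝ)} (hH : IsHypFamily H)
    (hu : Set.univ ∉ Set.range H) : regionNumber (Set.range H) = faceNumber (Set.range H) d := by
  have := Fintype.ofFinite ι
  have hM : complement Set.univ (Set.range H) =
      complement Set.univ (restriction (Set.range H) Set.univ) := by
    ext x
    rw [mem_complement_restriction]
    constructor
    · exact fun h => ⟨trivial, fun i _ hx => h.2 ⟨_, ⟨i, rfl⟩, hx⟩⟩
    · rintro ⟨-, h⟩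
      refine ⟨trivial, ?_⟩
      rintro ⟨K, ⟨i, rfl⟩, hx⟩
      exact h i (mem_free.2 fun h' => hu ⟨i, Set.eq_univ_of_univ_subset h'⟩) hx
  have huL : Set.univ ∈ L (Set.range H) :=
    mem_L_range.2 ⟨Set.univ_nonempty, ∅, inter_empty.symm⟩
  rw [regionNumber, faceNumber]
  congr 1
  ext C
  simp only [faces, regions, Set.mem_ofPred_eq, hM]
  constructor
  · exact fun h => ⟨Set.univ, huL, dim_univ, h⟩
  · rintro ⟨X, hX, hd, h⟩
    have : X = Set.univ := (isAff_of_mem_L hH hX).eq_of_subset_of_dim_eq isAff_univ hX.1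
      (Set.subset_univ _) (hd.trans dim_univ.symm)
    rwa [this] at h

variable [Fintype ι] [LinearOrder ι] {H H' : ι → Set (Fin d → ℝ)} {e : ι}

theorem Specializes.faceNumber_le (h : Specializes H H' e) (k : ℕ) :
    faceNumber (Set.range H) k ≤ faceNumber (Set.range H') k := by
  choose γ c hγ using h.hyp
  choose γ' c' hγ' using h.hyp'
  obtain rfl : H = fun i => hyperplane (γ i) (c i) := funext hγ
  obtain rfl : H' = fun i => hyperplane (γ' i) (c' i) := funext hγ'
  rw [faceNumber_eq_ncard, faceNumber_eq_ncard]
  exact_mod_cast h.ncard_pairs_le k fun _ => True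

theorem Specializes.regionNumber_le (h : Specializes H H' e) :
    regionNumber (Set.range H) ≤ regionNumber (Set.range H') := by
  by_cases hu : Set.univ ∈ Set.range H
  · rw [regionNumber_eq_zero hu]
    exact zero_le
  · rw [regionNumber_eq_faceNumber h.hyp hu,
      regionNumber_eq_faceNumber h.hyp' fun hu' => hu (h.univ_mem hu')]
    exact h.faceNumber_le d

end Faces

end HypArr

theorem theorem2p2 :
    (∀ (F : Type*) [Field F] (d m : ℕ) (β : Fin m → Fin d → F) (b : Fin m → F),
      (∀ i, β i ≠ 0) → Submodule.span F (Set.range β) = ⊤ →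
      ∀ (α α' : Fin d → F) (a a' : F) (X X' : Set (Fin (d + 1) → F)),
      HypArr.IsStratum (HypArr.inducedAdjoint β b) (Fin.snoc α a : Fin (d + 1) → F) X →
      HypArr.IsStratum (HypArr.inducedAdjoint β b) (Fin.snoc α' a' : Fin (d + 1) → F) X' →
      X ⊆ X' →
      (∀ i j, j ≤ i → i ≤ d →
        HypArr.whitneyCoeff (HypArr.extension (HypArr.arrangement β b) α a) i j ≤
          HypArr.whitneyCoeff (HypArr.extension (HypArr.arrangement β b) α' a') i j) ∧
      (∀ i, i ≤ d →
        HypArr.whitneyFirst (HypArr.extension (HypArr.arrangement β b) α a) i ≤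
          HypArr.whitneyFirst (HypArr.extension (HypArr.arrangement β b) α' a') i) ∧
      (∀ i, i ≤ d →
        HypArr.whitneySecond (HypArr.extension (HypArr.arrangement β b) α a) i ≤
          HypArr.whitneySecond (HypArr.extension (HypArr.arrangement β b) α' a') i)) ∧
    (∀ (d m : ℕ) (β : Fin m → Fin d → ℝ) (b : Fin m → ℝ),
      (∀ i, β i ≠ 0) → Submodule.span ℝ (Set.range β) = ⊤ →
      ∀ (α α' : Fin d → ℝ) (a a' : ℝ) (X X' : Set (Fin (d + 1) → ℝ)),
      HypArr.IsStratum (HypArr.inducedAdjoint β b) (Fin.snoc α a : Fin (d + 1) → ℝ) X →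
      HypArr.IsStratum (HypArr.inducedAdjoint β b) (Fin.snoc α' a' : Fin (d + 1) → ℝ) X' →
      X ⊆ X' →
      (∀ i, i ≤ d →
        HypArr.faceNumber (HypArr.extension (HypArr.arrangement β b) α a) i ≤
          HypArr.faceNumber (HypArr.extension (HypArr.arrangement β b) α' a') i) ∧
      HypArr.regionNumber (HypArr.extension (HypArr.arrangement β b) α a) ≤
        HypArr.regionNumber (HypArr.extension (HypArr.arrangement β b) α' a')) := by
  constructor
  · intro F _ d m β b _ hspan α α' a a' X X' hX hX' hsub
    have h := HypArr.specializes_of_isStratum hspan hX hX' hsub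
    have h1 := HypArr.extension_eq_range β b α a
    have h2 := HypArr.extension_eq_range β b α' a'
    refine ⟨fun i j hj hi => h.whitneyCoeff_le h1 h2 hj hi,
      fun i hi => h.whitneyFirst_le h1 h2 hi, fun i _ => ?_⟩
    rw [h1, h2]
    exact h.whitneySecond_le i
  · intro d m β b _ hspan α α' a a' X X' hX hX' hsub
    have h := HypArr.specializes_of_isStratum hspan hX hX' hsub
    rw [HypArr.extension_eq_range, HypArr.extension_eq_range]
    exact ⟨fun i _ => h.faceNumber_le i, h.regionNumber_le⟩
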